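/- Let $n,p,m\ge 1$. Consider the noise-free linear system $x_{k+1}=Ax_k$, $y_k=Cx_k+Dd_k$ ($k\ge 0$) with $x_k\in\mathbb R^n$, $y_k\in\mathbb R^p$, $d_k\in\mathbb R^m$, where $A$ is invertible and $(A,C)$ is detectable (some $A-LC$ has all its eigenvalues in the open unit disc), and let $Q>0$ and $R>0$ be symmetric positive definite. The innovation-saturated Kalman filter is $$\hat x_{k+1|k}=A\hat x_{k|k},\quad P_{k+1|k}=AP_{k|k}A^\top+Q,\quad \hat x_{k|k}=\hat x_{k|k-1}+K_k\,\mathrm{sat}_{\sigma_k}(y_k-C\hat x_{k|k-1}),$$ $$K_k=P_{k|k-1}C^\top(CP_{k|k-1}C^\top+R)^{-1},\quad P_{k|k}=P_{k|k-1}-K_k(CP_{k|k-1}C^\top+R)K_k^\top,$$ with $P_{0|-1}>0$ and arbitrary $\hat x_{0|-1}$, where $\mathrm{sat}_\sigma(r)_i=\max\{-\sqrt{\sigma_i},\min\{\sqrt{\sigma_i},r_i\}\}$ and, for $i=1,\dots,p$, $$\sigma_{i,k+1}=\lambda_{1,i}\sigma_{i,k}+\gamma_{1,i}\varepsilon_{i,k}e^{-\varepsilon_{i,k}},\qquad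 \varepsilon_{i,k+1}=\lambda_{2,i}\varepsilon_{i,k}+\gamma_{2,i}\big(y_{i,k}-(C\hat x_{k|k-1})_i\big)^2,$$ with $\sigma_{i,0},\varepsilon_{i,0}>0$, $0<\lambda_{1,i},\lambda_{2,i}<1$ and $\gamma_{1,i},\gamma_{2,i}>0$. Put $\Gamma_2=\mathrm{diag}(\gamma_{2,i})$, $\rho=e^{-1}\sum_i\gamma_{1,i}$, $e_k=\hat x_{k|k-1}-x_k$ and $V_0=e_0^\top P_{0|-1}^{-1}e_0+\sum_i\sigma_{i,0}+\sum_i\varepsilon_{i,0}$. Matrix inequalities are in the Loewner order, $\|\cdot\|$ is the Euclidean norm, and $\underline\lambda,\bar\lambda$ are the smallest and largest eigenvalues of a symmetric matrix. Then $P_{k|k-1}$ converges to a positive definite matrix $P_\infty$ with $P_\infty=AP_\infty A^\top+Q-AP_\infty C^\top(CP_\infty C^\top+R)^{-1}CP_\infty A^\top$, and there is $\epsilon$ with $P_{k|k}^{-1}\le\epsilon I$ for all $k$. Fix any such $\epsilon$ and let $\bar Q=(\epsilon I+A^\top Q^{-1}A)^{-1}$, $G_k=R^{-1}C(P_{k|k}-\bar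 Q)C^\top R^{-1}$, $$T_{1,k}=C^\top R^{-1}C+P_{k|k}^{-1}\bar QP_{k|k}^{-1}-P_{k|k}^{-1}\bar QC^\top R^{-1}C-C^\top R^{-1}C\bar QP_{k|k}^{-1}-C^\top G_kC-C^\top\Gamma_2C,$$ $$T_{2,k}=-C^\top R^{-1}+P_{k|k}^{-1}\bar QC^\top R^{-1}+C^\top G_k,\quad T_{3,k}=(T_{2,k}+C^\top\Gamma_2)D,$$ $$T_{4,k}=-G_k,\quad T_{5,k}=-G_kD,\quad T_{6,k}=D^\top(G_k+\Gamma_2)D.$$ Let $W$ be a diagonal positive definite matrix, $U$ a positive definite matrix and $\alpha>0$ a scalar such that for every $k\ge0$ the symmetric block matrix $$Z_k=\begin{bmatrix}T_{1,k}-\alpha P_{k|k-1}^{-1}&T_{2,k}-C^\top W&T_{3,k}\\ \star&T_{4,k}+2W&T_{5,k}+WD\\ \star&\star&U\end{bmatrix}$$ is positive semidefinite, and suppose $0<\alpha\le1-\max_i\max\{\lambda_{1,i},\lambda_{2,i}\}$. Then $T_{6,k}$ is bounded above, i.e. there is a symmetric matrix $\bar T_6$ with $T_{6,k}\le\bar T_6$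 for all $k$. For any such $\bar T_6$, put $c_1=\bar\lambda(\bar T_6+U)$, $c_2=c_2(k)=\underline\lambda(P_{k|k-1}^{-1})$ and $c_3=\underline\lambda(P_\infty^{-1})$. If $\|d_k\|\le\mu<\infty$ for all $k$, then for all $k\ge0$ $$\|e_k\|\le\sqrt{\frac1{c_2}\Big[(1-\alpha)^kV_0+\frac{1-(1-\alpha)^{k}}{\alpha}(c_1\mu^2+\rho)\Big]},\qquad \limsup_{k\to\infty}\|e_k\|\le\sqrt{\frac{c_1\mu^2+\rho}{\alpha c_3}}.$$ If moreover $0<\alpha\le1-\max_i\max\{\lambda_{1,i},\lambda_{2,i}+\gamma_{1,i}\}$, then for all $k\ge0$ $$\|e_k\|\le\sqrt{\frac1{c_2}\Big[(1-\alpha)^kV_0+\frac{1-(1-\alpha)^{k}}{\alpha}c_1\mu^2\Big]},\qquad \limsup_{k\to\infty}\|e_k\|\le\sqrt{\frac{c_1}{\alpha c_3}}\,\mu.$$ -/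

import Mathlib

open Matrix Filter Topology

noncomputable section

namespace ISKF

/-- The Euclidean norm of a vector of `ℝⁿ`. -/
def enorm2 {n : ℕ} (v : Fin n → ℝ) : ℝ := ‖WithLp.toLp 2 v‖

/-- Smallest eigenvalue of a real symmetric matrix. -/
def lamMin {n : ℕ} (M : Matrix (Fin n) (Fin n) ℝ) : ℝ := sInf (spectrum ℝ M)

/-- Largest eigenvalue of a real symmetric matrix. -/
def lamMax {n : ℕ} (M : Matrix (Fin n) (Fin n) ℝ) : ℝ := sSup (spectrum ℝ M)

/-- Loewner order: `M ≤ N` iff `N - M` is symmetric positive semidefinite. -/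
def LoewnerLE {n : ℕ} (M N : Matrix (Fin n) (Fin n) ℝ) : Prop := (N - M).PosSemidef

/-- `(A, C)` is detectable (discrete time): some output injection `L` makes all complex
eigenvalues of `A - L C` lie in the open unit disc. -/
def Detectable {n p : ℕ} (A : Matrix (Fin n) (Fin n) ℝ) (C : Matrix (Fin p) (Fin n) ℝ) : Prop :=
  ∃ L : Matrix (Fin n) (Fin p) ℝ,
    ∀ z ∈ spectrum ℂ ((A - L * C).map (algebraMap ℝ ℂ)), ‖z‖ < 1

/-- The saturation function with range `[-b, b]`. -/
def sat (b r : ℝ) : ℝ := max (-b) (min b r)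

/-- Componentwise saturation, the `i`-th component having range `[-√σᵢ, √σᵢ]`. -/
def satVec {p : ℕ} (σ : Fin p → ℝ) (r : Fin p → ℝ) : Fin p → ℝ :=
  fun i => sat (Real.sqrt (σ i)) (r i)

/-- The noise-free linear system `x_{k+1} = A x_k`, `y_k = C x_k + D d_k`. -/
structure IsPlant {n p m : ℕ} (A : Matrix (Fin n) (Fin n) ℝ) (C : Matrix (Fin p) (Fin n) ℝ)
    (D : Matrix (Fin p) (Fin m) ℝ) (d : ℕ → Fin m → ℝ)
    (x : ℕ → Fin n → ℝ) (y : ℕ → Fin p → ℝ) : Prop where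
  state : ∀ k, x (k + 1) = A *ᵥ x k
  output : ∀ k, y k = C *ᵥ x k + D *ᵥ d k

/-- The covariance recursion of the filter. `Pp k` is `P_{k|k-1}` (so `Pp 0` is `P_{0|-1}`),
`Pu k` is `P_{k|k}` and `K k` is the gain. -/
structure IsCovariance {n p : ℕ} (A : Matrix (Fin n) (Fin n) ℝ) (C : Matrix (Fin p) (Fin n) ℝ)
    (Q : Matrix (Fin n) (Fin n) ℝ) (R : Matrix (Fin p) (Fin p) ℝ)
    (Pp Pu : ℕ → Matrix (Fin n) (Fin n) ℝ) (K : ℕ → Matrix (Fin n) (Fin p) ℝ) : Prop where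
  init : (Pp 0).PosDef
  predict : ∀ k, Pp (k + 1) = A * Pu k * Aᵀ + Q
  gain : ∀ k, K k = Pp k * Cᵀ * (C * Pp k * Cᵀ + R)⁻¹
  update : ∀ k, Pu k = Pp k - K k * (C * Pp k * Cᵀ + R) * (K k)ᵀ

/-- The state estimates of the innovation-saturated Kalman filter with gains `K`, driven by
the measurements `y`: `xp k` is the prediction `x̂_{k|k-1}`, `xu k` the update `x̂_{k|k}`,
`σ k i` the (squared) saturation bound and `ε k i` the variable tracking the innovation. -/
structure IsEstimator {n p : ℕ} (A : Matrix (Fin n) (Fin n) ℝ) (C : Matrix (Fin p) (Fin n) ℝ)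
    (K : ℕ → Matrix (Fin n) (Fin p) ℝ) (lam1 lam2 gam1 gam2 : Fin p → ℝ)
    (y : ℕ → Fin p → ℝ) (xp xu : ℕ → Fin n → ℝ) (σ ε : ℕ → Fin p → ℝ) : Prop where
  sigma_init : ∀ i, 0 < σ 0 i
  eps_init : ∀ i, 0 < ε 0 i
  predict : ∀ k, xp (k + 1) = A *ᵥ xu k
  update : ∀ k, xu k = xp k + K k *ᵥ satVec (σ k) (y k - C *ᵥ xp k)
  sigma_step : ∀ k i,
    σ (k + 1) i = lam1 i * σ k i + gam1 i * (ε k i * Real.exp (-ε k i))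
  eps_step : ∀ k i,
    ε (k + 1) i = lam2 i * ε k i + gam2 i * (y k i - (C *ᵥ xp k) i) ^ 2

/-- `P` solves the filtering algebraic Riccati equation. -/
def IsRiccatiSolution {n p : ℕ} (A : Matrix (Fin n) (Fin n) ℝ) (C : Matrix (Fin p) (Fin n) ℝ)
    (Q : Matrix (Fin n) (Fin n) ℝ) (R : Matrix (Fin p) (Fin p) ℝ)
    (P : Matrix (Fin n) (Fin n) ℝ) : Prop :=
  P = A * P * Aᵀ + Q - A * P * Cᵀ * (C * P * Cᵀ + R)⁻¹ * C * P * Aᵀ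

/-- `Q̄ = (ϵ I + Aᵀ Q⁻¹ A)⁻¹`. -/
def Qbar {n : ℕ} (A Q : Matrix (Fin n) (Fin n) ℝ) (eps : ℝ) : Matrix (Fin n) (Fin n) ℝ :=
  (eps • (1 : Matrix (Fin n) (Fin n) ℝ) + Aᵀ * Q⁻¹ * A)⁻¹

section Blocks

variable {n p m : ℕ} (C : Matrix (Fin p) (Fin n) ℝ) (D : Matrix (Fin p) (Fin m) ℝ)
  (R G2 : Matrix (Fin p) (Fin p) ℝ) (Qb Pu : Matrix (Fin n) (Fin n) ℝ)

/-- `T₁`, as a function of `Q̄` and `P_{k|k}`; here `G2` stands for `Γ₂`. -/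
def T1 : Matrix (Fin n) (Fin n) ℝ :=
  Cᵀ * R⁻¹ * C + Pu⁻¹ * Qb * Pu⁻¹ - Pu⁻¹ * Qb * Cᵀ * R⁻¹ * C - Cᵀ * R⁻¹ * C * Qb * Pu⁻¹
    - Cᵀ * R⁻¹ * C * (Pu - Qb) * Cᵀ * R⁻¹ * C - Cᵀ * G2 * C

/-- `T₂`. -/
def T2 : Matrix (Fin n) (Fin p) ℝ :=
  -(Cᵀ * R⁻¹) + Pu⁻¹ * Qb * Cᵀ * R⁻¹ + Cᵀ * R⁻¹ * C * (Pu - Qb) * Cᵀ * R⁻¹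

/-- `T₃`. -/
def T3 : Matrix (Fin n) (Fin m) ℝ :=
  (-(Cᵀ * R⁻¹) + Pu⁻¹ * Qb * Cᵀ * R⁻¹ + Cᵀ * R⁻¹ * C * (Pu - Qb) * Cᵀ * R⁻¹ + Cᵀ * G2) * D

/-- `T₄`. -/
def T4 : Matrix (Fin p) (Fin p) ℝ :=
  -(R⁻¹ * C * (Pu - Qb) * Cᵀ * R⁻¹)

/-- `T₅`. -/
def T5 : Matrix (Fin p) (Fin m) ℝ :=
  -(R⁻¹ * C * (Pu - Qb) * Cᵀ * R⁻¹) * D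

/-- `T₆`. -/
def T6 : Matrix (Fin m) (Fin m) ℝ :=
  Dᵀ * (R⁻¹ * C * (Pu - Qb) * Cᵀ * R⁻¹ + G2) * D

/-- The symmetric `3 × 3` block matrix `Z_k`, as a function of `Q̄`, `P_{k|k}`, `P_{k|k-1}`. -/
def Z (Pp : Matrix (Fin n) (Fin n) ℝ) (W : Matrix (Fin p) (Fin p) ℝ)
    (U : Matrix (Fin m) (Fin m) ℝ) (α : ℝ) :
    Matrix (Fin n ⊕ (Fin p ⊕ Fin m)) (Fin n ⊕ (Fin p ⊕ Fin m)) ℝ :=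
  let Z12 : Matrix (Fin n) (Fin p) ℝ := T2 C R Qb Pu - Cᵀ * W
  let Z13 : Matrix (Fin n) (Fin m) ℝ := T3 C D R G2 Qb Pu
  let Z23 : Matrix (Fin p) (Fin m) ℝ := T5 C D R Qb Pu + W * D
  fromBlocks (T1 C R G2 Qb Pu - α • Pp⁻¹) (fromCols Z12 Z13)
    (fromCols Z12 Z13)ᵀ
    (fromBlocks (T4 C R Qb Pu + (2 : ℝ) • W) Z23 Z23ᵀ U)

end Blocks

/-- The initial value `V₀ = e₀ᵀ P_{0|-1}⁻¹ e₀ + ∑ᵢ σ_{i,0} + ∑ᵢ ε_{i,0}`. -/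
def V0 {n p : ℕ} (P0 : Matrix (Fin n) (Fin n) ℝ) (e0 : Fin n → ℝ) (σ0 ε0 : Fin p → ℝ) : ℝ :=
  e0 ⬝ᵥ (P0⁻¹ *ᵥ e0) + ∑ i, σ0 i + ∑ i, ε0 i

end ISKF

end

set_option linter.unusedSectionVars false

/-! The Lyapunov function is V = eᵀ P⁻¹ e + ∑ σ + ∑ ε, with P = P_{k|k-1}. With innovation r = D d -
C e and s = sat(r), the error obeys e⁺ = A (e + K s). The matrix inversion lemma and the bound
P_{k|k}⁻¹ ≤ ϵ I dominate the next quadratic term by the form of P_{k|k}⁻¹ - P_{k|k}⁻¹ Q̄ P_{k|k}⁻¹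
at e + K s (`form_predict_le`). Adding rᵀ Γ₂ r, the input of the ε recursion, gives exactly (1 - α)
eᵀ P⁻¹ e + dᵀ (T₆ + U) d, minus the form of Z at (e, s - r, d), plus 2 (s - r)ᵀ W s (`form_Z_eq`).
The last two contributions are nonpositive, by Z ≥ 0 and by the sector property of saturation. The
rest is scalar: t exp(-t) ≤ exp(-1) costs the constant ρ, while t exp(-t) ≤ t is absorbed by the
decay of ε. Iterating V⁺ ≤ (1 - α) V + const gives both pairs of bounds.

Convergence of the covariances is an order argument. Detectability bounds the Riccati orbit
(`exists_riccati_bound`). The Riccati map is monotone and, because Q > 0 is not rescaled with P,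
strictly subhomogeneous; hence the ratio between any two tails of the orbit contracts to 1
(`riccatiMap_le_smul`) and the orbit is Cauchy. -/

namespace ISKF

open scoped MatrixOrder

/-! ### Quadratic forms and the Loewner order. -/

section LoewnerOrder

variable {ι κ : Type*} [Fintype ι] [Fintype κ] [DecidableEq ι] [DecidableEq κ]

theorem dotProduct_mulVec_comm_of_isHermitian {M : Matrix ι ι ℝ} (hM : M.IsHermitian)
    (x y : ι → ℝ) : x ⬝ᵥ (M *ᵥ y) = y ⬝ᵥ (M *ᵥ x) := by
  rw [dotProduct_mulVec, dotProduct_comm, ← mulVec_transpose]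
  have : Mᵀ = M := isHermitian_iff_isSymm.1 hM
  rw [this]

theorem dotProduct_transpose_mulVec (M : Matrix κ ι ℝ) (x : ι → ℝ) (y : κ → ℝ) :
    x ⬝ᵥ (Mᵀ *ᵥ y) = (M *ᵥ x) ⬝ᵥ y := by
  rw [dotProduct_mulVec, vecMul_transpose]

theorem posSemidef_iff_form {M : Matrix ι ι ℝ} :
    M.PosSemidef ↔ M.IsHermitian ∧ ∀ x : ι → ℝ, 0 ≤ x ⬝ᵥ (M *ᵥ x) := by
  simpa using posSemidef_iff_dotProduct_mulVec (M := M)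

theorem form_nonneg {M : Matrix ι ι ℝ} (hM : M.PosSemidef) (x : ι → ℝ) :
    0 ≤ x ⬝ᵥ (M *ᵥ x) := (posSemidef_iff_form.1 hM).2 x

theorem form_le_of_le {M N : Matrix ι ι ℝ} (h : M ≤ N) (x : ι → ℝ) :
    x ⬝ᵥ (M *ᵥ x) ≤ x ⬝ᵥ (N *ᵥ x) := by
  have := form_nonneg (Matrix.le_iff.1 h) x
  rw [sub_mulVec, dotProduct_sub] at this
  linarith

theorem le_of_form_le {M N : Matrix ι ι ℝ} (hM : M.IsHermitian) (hN : N.IsHermitian)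
    (h : ∀ x : ι → ℝ, x ⬝ᵥ (M *ᵥ x) ≤ x ⬝ᵥ (N *ᵥ x)) : M ≤ N := by
  rw [Matrix.le_iff, posSemidef_iff_form]
  refine ⟨hN.sub hM, fun x => ?_⟩
  rw [sub_mulVec, dotProduct_sub]
  linarith [h x]

theorem form_smul_one (c : ℝ) (x : ι → ℝ) :
    x ⬝ᵥ ((c • (1 : Matrix ι ι ℝ)) *ᵥ x) = c * (x ⬝ᵥ x) := by
  simp [smul_mulVec]

theorem isHermitian_smul_one (c : ℝ) : (c • (1 : Matrix ι ι ℝ)).IsHermitian := by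
  simp [IsHermitian]

theorem mul_mul_transpose_mono {M N : Matrix ι ι ℝ} (h : M ≤ N) (B : Matrix κ ι ℝ) :
    B * M * Bᵀ ≤ B * N * Bᵀ := by
  rw [Matrix.le_iff] at h ⊢
  simpa [Matrix.mul_sub, Matrix.sub_mul] using h.mul_mul_conjTranspose_same B

theorem smul_mono_right {M N : Matrix ι ι ℝ} (h : M ≤ N) {c : ℝ} (hc : 0 ≤ c) :
    c • M ≤ c • N := by
  rw [Matrix.le_iff] at h ⊢
  simpa [smul_sub] using h.smul hc

theorem smul_mono_left {M : Matrix ι ι ℝ} (hM : M.PosSemidef) {c d : ℝ} (h : c ≤ d) :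
    c • M ≤ d • M := by
  rw [Matrix.le_iff, ← sub_smul]
  exact hM.smul (sub_nonneg.2 h)

theorem posDef_of_le {M N : Matrix ι ι ℝ} (hM : M.PosDef) (h : M ≤ N) : N.PosDef := by
  have := hM.add_posSemidef (Matrix.le_iff.1 h)
  simpa using this

theorem inv_mul_cancel_of_posDef {M : Matrix ι ι ℝ} (hM : M.PosDef) : M⁻¹ * M = 1 :=
  nonsing_inv_mul _ ((isUnit_iff_isUnit_det _).1 hM.isUnit)

theorem mul_inv_cancel_of_posDef {M : Matrix ι ι ℝ} (hM : M.PosDef) : M * M⁻¹ = 1 :=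
  mul_nonsing_inv _ ((isUnit_iff_isUnit_det _).1 hM.isUnit)

theorem inv_inv_of_posDef {M : Matrix ι ι ℝ} (hM : M.PosDef) : M⁻¹⁻¹ = M :=
  nonsing_inv_nonsing_inv _ ((isUnit_iff_isUnit_det _).1 hM.isUnit)

/-- Inversion is antitone on positive definite matrices. -/
theorem inv_le_inv_of_le {M N : Matrix ι ι ℝ} (hM : M.PosDef) (h : M ≤ N) : N⁻¹ ≤ M⁻¹ := by
  have hN := posDef_of_le hM h
  refine le_of_form_le hN.inv.isHermitian hM.inv.isHermitian fun x => ?_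
  -- Expanding 0 ≤ (z - y)ᵀ M (z - y) and using yᵀ M y ≤ yᵀ N y = yᵀ x leaves yᵀ x ≤ zᵀ x.
  set y := N⁻¹ *ᵥ x with hy
  set z := M⁻¹ *ᵥ x with hz
  have hNy : N *ᵥ y = x := by
    rw [hy, mulVec_mulVec, mul_inv_cancel_of_posDef hN, one_mulVec]
  have hMz : M *ᵥ z = x := by
    rw [hz, mulVec_mulVec, mul_inv_cancel_of_posDef hM, one_mulVec]
  have h1 := form_nonneg hM.posSemidef (z - y)
  have h2 := form_le_of_le h y
  have h3 := dotProduct_mulVec_comm_of_isHermitian hM.isHermitian z y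
  simp only [mulVec_sub, dotProduct_sub, sub_dotProduct, hMz] at h1 h3
  rw [hNy] at h2
  rw [dotProduct_comm x y, dotProduct_comm x z]
  linarith

/-- A symmetric matrix is bounded by the sum of the absolute values of its entries. -/
theorem le_sum_abs_smul_one {M : Matrix ι ι ℝ} (hM : M.IsHermitian) :
    M ≤ (∑ i, ∑ j, |M i j|) • (1 : Matrix ι ι ℝ) := by
  refine le_of_form_le hM (isHermitian_smul_one _) fun x => ?_
  rw [form_smul_one]
  have hx : ∀ i, x i ^ 2 ≤ x ⬝ᵥ x := fun i => by
    rw [dotProduct, pow_two]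
    exact Finset.single_le_sum (f := fun i => x i * x i) (fun j _ => mul_self_nonneg _)
      (Finset.mem_univ i)
  have h0 : x ⬝ᵥ (M *ᵥ x) = ∑ i, ∑ j, x i * (M i j * x j) := by
    simp only [dotProduct, mulVec, Finset.mul_sum]
  rw [h0]
  simp only [Finset.sum_mul]
  refine Finset.sum_le_sum fun i _ => Finset.sum_le_sum fun j _ => ?_
  have h1 : x i * (M i j * x j) ≤ |M i j| * (|x i| * |x j|) := by
    calc x i * (M i j * x j) ≤ |x i * (M i j * x j)| := le_abs_self _
      _ = _ := by rw [abs_mul, abs_mul]; ring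
  refine h1.trans (mul_le_mul_of_nonneg_left ?_ (abs_nonneg _))
  have := two_mul_le_add_sq |x i| |x j|
  rw [sq_abs, sq_abs] at this
  linarith [hx i, hx j]

/-- The entries of a symmetric matrix between `-δ I` and `δ I` are at most `δ`. -/
theorem abs_apply_le_of_le {M : Matrix ι ι ℝ} {δ : ℝ} (h1 : M ≤ δ • (1 : Matrix ι ι ℝ))
    (h2 : -(δ • (1 : Matrix ι ι ℝ)) ≤ M) (hM : M.IsHermitian) (i j : ι) : |M i j| ≤ δ := by
  -- Polarization: 4 xᵀ M y is the form at x + y minus the form at x - y. Testing on ± basis vectors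
  -- then isolates an entry.
  have key : ∀ x y : ι → ℝ, 4 * (x ⬝ᵥ (M *ᵥ y)) ≤ δ * (2 * (x ⬝ᵥ x) + 2 * (y ⬝ᵥ y)) := by
    intro x y
    have a := form_le_of_le h1 (x + y)
    have b := form_le_of_le h2 (x - y)
    rw [neg_mulVec, dotProduct_neg, form_smul_one] at b
    rw [form_smul_one] at a
    have c := dotProduct_mulVec_comm_of_isHermitian hM x y
    simp only [mulVec_add, mulVec_sub, dotProduct_add, add_dotProduct, dotProduct_sub,
      sub_dotProduct, dotProduct_comm y x] at a b
    linarith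
  have e : ∀ k : ι, (Pi.single k (1 : ℝ) : ι → ℝ) ⬝ᵥ Pi.single k 1 = 1 := fun k => by simp
  have k1 := key (Pi.single i 1) (Pi.single j 1)
  have k2 := key (-Pi.single i 1) (Pi.single j 1)
  simp only [neg_dotProduct, dotProduct_neg, e] at k1 k2
  have : (Pi.single i (1 : ℝ) : ι → ℝ) ⬝ᵥ (M *ᵥ Pi.single j 1) = M i j := by simp
  rw [this] at k1 k2
  rw [abs_le]
  constructor <;> linarith

end LoewnerOrder

/-! ### Extreme eigenvalues and the Euclidean norm. -/

section Eigenvalues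

variable {n : ℕ}

theorem lamMin_smul_one_le {M : Matrix (Fin n) (Fin n) ℝ} (hM : M.IsHermitian) :
    lamMin M • (1 : Matrix (Fin n) (Fin n) ℝ) ≤ M := by
  rw [Matrix.le_iff, posSemidef_iff_isHermitian_and_spectrum_nonneg]
  refine ⟨hM.sub (isHermitian_smul_one _), fun a ha => ?_⟩
  have hr : a + lamMin M ∈ spectrum ℝ M := by
    rw [← Algebra.algebraMap_eq_smul_one, sub_eq_neg_add, ← spectrum.add_mem_iff] at ha
    exact ha
  have hf : (spectrum ℝ M).Finite := by
    rw [hM.spectrum_real_eq_range_eigenvalues]; exact Set.finite_range _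
  have := csInf_le hf.bddBelow hr
  change lamMin M ≤ _ at this
  change 0 ≤ a
  linarith

theorem le_lamMax_smul_one {M : Matrix (Fin n) (Fin n) ℝ} (hM : M.IsHermitian) :
    M ≤ lamMax M • (1 : Matrix (Fin n) (Fin n) ℝ) := by
  have h := lamMin_smul_one_le hM.neg
  have : lamMin (-M) = -lamMax M := by
    rw [lamMin, lamMax, ← Real.sInf_neg, spectrum.neg_eq]
  rw [this, neg_smul] at h
  exact neg_le_neg_iff.1 h

/-- Positive dimension is essential: on an empty spectrum `lamMin` is `sInf ∅ = 0`. -/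
theorem lamMin_pos {M : Matrix (Fin n) (Fin n) ℝ} (hn : 0 < n) (hM : M.PosDef) :
    0 < lamMin M := by
  have : Nonempty (Fin n) := ⟨⟨0, hn⟩⟩
  have hs := hM.isHermitian.spectrum_real_eq_range_eigenvalues
  have : lamMin M ∈ Set.range hM.isHermitian.eigenvalues := by
    rw [lamMin, hs]
    exact (Set.range_nonempty _).csInf_mem (Set.finite_range _)
  obtain ⟨i, hi⟩ := this
  rw [← hi]
  exact hM.eigenvalues_pos i

theorem enorm2_sq (v : Fin n → ℝ) : enorm2 v ^ 2 = v ⬝ᵥ v := by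
  rw [enorm2, EuclideanSpace.norm_sq_eq]
  simp [dotProduct, pow_two]

theorem enorm2_nonneg (v : Fin n → ℝ) : 0 ≤ enorm2 v := norm_nonneg _

theorem lamMin_mul_enorm2_sq_le {M : Matrix (Fin n) (Fin n) ℝ} (hM : M.IsHermitian)
    (v : Fin n → ℝ) : lamMin M * enorm2 v ^ 2 ≤ v ⬝ᵥ (M *ᵥ v) := by
  have := form_le_of_le (lamMin_smul_one_le hM) v
  rwa [form_smul_one, ← enorm2_sq] at this

theorem le_lamMax_mul_enorm2_sq {M : Matrix (Fin n) (Fin n) ℝ} (hM : M.IsHermitian)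
    (v : Fin n → ℝ) : v ⬝ᵥ (M *ᵥ v) ≤ lamMax M * enorm2 v ^ 2 := by
  have := form_le_of_le (le_lamMax_smul_one hM) v
  rwa [form_smul_one, ← enorm2_sq] at this

end Eigenvalues

/-! ### Powers of Schur stable matrices. -/

section StableMatrix

/-- The powers of an element of spectral radius less than one tend to zero. -/
theorem tendsto_pow_of_forall_spectrum_norm_lt_one {𝔸 : Type*} [NormedRing 𝔸]
    [NormedAlgebra ℂ 𝔸] [CompleteSpace 𝔸] (a : 𝔸)
    (h : ∀ z ∈ spectrum ℂ a, ‖z‖ < 1) : Tendsto (fun k : ℕ => a ^ k) atTop (𝓝 0) := by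
  rcases subsingleton_or_nontrivial 𝔸 with hs | hs
  · exact tendsto_const_nhds.congr fun k => Subsingleton.elim _ _
  have hr : spectralRadius ℂ a < 1 := by
    have := spectrum.spectralRadius_lt_of_forall_lt a (r := 1) fun z hz => by
      simpa [← NNReal.coe_lt_coe] using h z hz
    simpa using this
  -- Gelfand's formula: ‖aᵏ‖^(1/k) tends to the spectral radius, so ‖aᵏ‖ ≤ rᵏ eventually, for some r
  -- < 1.
  obtain ⟨r, hr1, hr2⟩ := ENNReal.lt_iff_exists_nnreal_btwn.1 hr
  have hr2' : r < 1 := by simpa using hr2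
  have hev := (spectrum.pow_nnnorm_pow_one_div_tendsto_nhds_spectralRadius a).eventually_lt_const hr1
  have hle : ∀ᶠ k : ℕ in atTop, ‖a ^ k‖ ≤ (r : ℝ) ^ k := by
    filter_upwards [hev, eventually_gt_atTop 0] with k hk hk0
    have hk' : (0 : ℝ) < k := by exact_mod_cast hk0
    have h1 : (‖a ^ k‖₊ : ENNReal) ≤ (r : ENNReal) ^ (k : ℝ) := by
      rw [one_div] at hk
      exact (ENNReal.rpow_inv_le_iff hk').1 hk.le
    rw [ENNReal.rpow_natCast] at h1
    exact_mod_cast h1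
  refine squeeze_zero_norm' hle ?_
  exact tendsto_pow_atTop_nhds_zero_of_lt_one r.2 (by exact_mod_cast hr2')

theorem tendsto_pow_matrix_of_forall_spectrum_norm_lt_one {n : ℕ} (F : Matrix (Fin n) (Fin n) ℝ)
    (h : ∀ z ∈ spectrum ℂ (F.map (algebraMap ℝ ℂ)), ‖z‖ < 1) :
    Tendsto (fun k : ℕ => F ^ k) atTop (𝓝 0) := by
  have h1 : Tendsto (fun k : ℕ => (F.map (algebraMap ℝ ℂ)) ^ k) atTop (𝓝 0) := by
    -- Any Banach algebra norm inducing the entrywise topology will do; only convergence leaves this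
    -- block.
    let _ : NormedRing (Matrix (Fin n) (Fin n) ℂ) := Matrix.linftyOpNormedRing
    let _ : NormedAlgebra ℂ (Matrix (Fin n) (Fin n) ℂ) := Matrix.linftyOpNormedAlgebra
    exact tendsto_pow_of_forall_spectrum_norm_lt_one _ h
  refine tendsto_pi_nhds.2 fun i => tendsto_pi_nhds.2 fun j => ?_
  have h2 := ((tendsto_pi_nhds.1 ((tendsto_pi_nhds.1 h1) i)) j)
  have h3 : Tendsto (fun k : ℕ => (((F ^ k) i j : ℝ) : ℂ)) atTop (𝓝 ((0 : ℝ) : ℂ)) := by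
    refine h2.congr fun k => ?_
    have : (F.map (algebraMap ℝ ℂ)) ^ k = (F ^ k).map (algebraMap ℝ ℂ) := by
      simpa using (map_pow (algebraMap ℝ ℂ).mapMatrix F k).symm
    rw [this]; rfl
  exact (Complex.continuous_re.tendsto _).comp h3

end StableMatrix

/-! ### The Riccati map: order properties, boundedness and convergence. -/

section Riccati

variable {n p : ℕ} {A : Matrix (Fin n) (Fin n) ℝ} {C : Matrix (Fin p) (Fin n) ℝ}
  {Q : Matrix (Fin n) (Fin n) ℝ} {R : Matrix (Fin p) (Fin p) ℝ}

theorem mul_mul_transpose_posSemidef {ι κ : Type*} [Fintype ι] [Fintype κ] {M : Matrix ι ι ℝ}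
    (hM : M.PosSemidef) (B : Matrix κ ι ℝ) : (B * M * Bᵀ).PosSemidef := by
  simpa using hM.mul_mul_conjTranspose_same B

theorem transpose_mul_mul_posSemidef {ι κ : Type*} [Fintype ι] [Fintype κ] {M : Matrix ι ι ℝ}
    (hM : M.PosSemidef) (B : Matrix ι κ ℝ) : (Bᵀ * M * B).PosSemidef := by
  simpa using hM.conjTranspose_mul_mul_same B

theorem posDef_innovation (hR : R.PosDef) {P : Matrix (Fin n) (Fin n) ℝ} (hP : P.PosSemidef) :
    (C * P * Cᵀ + R).PosDef :=
  PosDef.posSemidef_add (mul_mul_transpose_posSemidef hP C) hR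

/-- The measurement update in information form, `P ↦ (P⁻¹ + Cᵀ R⁻¹ C)⁻¹`. -/
noncomputable def infoUpdate (C : Matrix (Fin p) (Fin n) ℝ) (R : Matrix (Fin p) (Fin p) ℝ)
    (P : Matrix (Fin n) (Fin n) ℝ) : Matrix (Fin n) (Fin n) ℝ :=
  (P⁻¹ + Cᵀ * R⁻¹ * C)⁻¹

/-- The Riccati map `P ↦ A (P⁻¹ + Cᵀ R⁻¹ C)⁻¹ Aᵀ + Q`. -/
noncomputable def riccatiMap (A : Matrix (Fin n) (Fin n) ℝ) (C : Matrix (Fin p) (Fin n) ℝ)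
    (Q : Matrix (Fin n) (Fin n) ℝ) (R : Matrix (Fin p) (Fin p) ℝ)
    (P : Matrix (Fin n) (Fin n) ℝ) : Matrix (Fin n) (Fin n) ℝ :=
  A * infoUpdate C R P * Aᵀ + Q

theorem posDef_information (hR : R.PosDef) {P : Matrix (Fin n) (Fin n) ℝ} (hP : P.PosDef) :
    (P⁻¹ + Cᵀ * R⁻¹ * C).PosDef :=
  hP.inv.add_posSemidef (transpose_mul_mul_posSemidef hR.inv.posSemidef C)

theorem posDef_infoUpdate (hR : R.PosDef) {P : Matrix (Fin n) (Fin n) ℝ} (hP : P.PosDef) :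
    (infoUpdate C R P).PosDef :=
  (posDef_information hR hP).inv

theorem inv_infoUpdate (hR : R.PosDef) {P : Matrix (Fin n) (Fin n) ℝ} (hP : P.PosDef) :
    (infoUpdate C R P)⁻¹ = P⁻¹ + Cᵀ * R⁻¹ * C :=
  inv_inv_of_posDef (posDef_information hR hP)

theorem infoUpdate_eq (hR : R.PosDef) {P : Matrix (Fin n) (Fin n) ℝ} (hP : P.PosDef) :
    infoUpdate C R P = P - P * Cᵀ * (C * P * Cᵀ + R)⁻¹ * C * P := by
  have hS := posDef_innovation (C := C) hR hP.posSemidef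
  rw [infoUpdate, add_mul_mul_inv_eq_sub _ _ _ _ hP.inv.isUnit hR.inv.isUnit,
    inv_inv_of_posDef hP, inv_inv_of_posDef hR, add_comm R]
  rw [inv_inv_of_posDef hP, inv_inv_of_posDef hR, add_comm R]
  exact hS.isUnit

/-- The push-through identity `h1` moves the inverse from the innovation covariance to the
information matrix. -/
theorem gain_eq_infoUpdate (hR : R.PosDef) {P : Matrix (Fin n) (Fin n) ℝ} (hP : P.PosDef) :
    P * Cᵀ * (C * P * Cᵀ + R)⁻¹ = infoUpdate C R P * Cᵀ * R⁻¹ := by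
  have hS := posDef_innovation (C := C) hR hP.posSemidef
  have hI := posDef_information (C := C) hR hP
  have h1 : (P⁻¹ + Cᵀ * R⁻¹ * C) * (P * Cᵀ) = Cᵀ * R⁻¹ * (C * P * Cᵀ + R) := by
    rw [Matrix.add_mul, Matrix.mul_add, ← Matrix.mul_assoc P⁻¹, inv_mul_cancel_of_posDef hP,
      Matrix.one_mul, Matrix.mul_assoc Cᵀ R⁻¹ R, inv_mul_cancel_of_posDef hR, Matrix.mul_one,
      add_comm]
    simp only [Matrix.mul_assoc]
  calc P * Cᵀ * (C * P * Cᵀ + R)⁻¹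
      = (infoUpdate C R P * (P⁻¹ + Cᵀ * R⁻¹ * C)) * (P * Cᵀ) * (C * P * Cᵀ + R)⁻¹ := by
        rw [infoUpdate, inv_mul_cancel_of_posDef hI, Matrix.one_mul]
    _ = infoUpdate C R P * ((P⁻¹ + Cᵀ * R⁻¹ * C) * (P * Cᵀ)) * (C * P * Cᵀ + R)⁻¹ := by
        simp only [Matrix.mul_assoc]
    _ = infoUpdate C R P * Cᵀ * R⁻¹ * ((C * P * Cᵀ + R) * (C * P * Cᵀ + R)⁻¹) := by
        rw [h1]; simp only [Matrix.mul_assoc]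
    _ = _ := by rw [mul_inv_cancel_of_posDef hS, Matrix.mul_one]

theorem infoUpdate_mono (hR : R.PosDef) {P P' : Matrix (Fin n) (Fin n) ℝ} (hP : P.PosDef)
    (h : P ≤ P') : infoUpdate C R P ≤ infoUpdate C R P' :=
  inv_le_inv_of_le (posDef_information hR (posDef_of_le hP h))
    (add_le_add_left (inv_le_inv_of_le hP h) _)

theorem infoUpdate_le (hR : R.PosDef) {P : Matrix (Fin n) (Fin n) ℝ} (hP : P.PosDef) :
    infoUpdate C R P ≤ P := by
  have : P⁻¹ ≤ P⁻¹ + Cᵀ * R⁻¹ * C := by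
    rw [Matrix.le_iff, add_sub_cancel_left]
    exact transpose_mul_mul_posSemidef hR.inv.posSemidef C
  have := inv_le_inv_of_le hP.inv this
  rwa [inv_inv_of_posDef hP] at this

theorem inv_smul_of_posDef {P : Matrix (Fin n) (Fin n) ℝ} (hP : P.PosDef) {t : ℝ} (ht : 0 < t) :
    (t • P)⁻¹ = t⁻¹ • P⁻¹ := by
  refine inv_eq_right_inv ?_
  rw [Matrix.smul_mul, Matrix.mul_smul, smul_smul, mul_inv_cancel_of_posDef hP,
    mul_inv_cancel₀ ht.ne', one_smul]

/-- Scaling P by t ≥ 1 divides the prior information by t but leaves Cᵀ R⁻¹ C untouched, so the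
total is at least t⁻¹ times the old one. -/
theorem infoUpdate_smul_le (hR : R.PosDef) {P : Matrix (Fin n) (Fin n) ℝ} (hP : P.PosDef)
    {t : ℝ} (ht : 1 ≤ t) : infoUpdate C R (t • P) ≤ t • infoUpdate C R P := by
  have ht0 : 0 < t := by linarith
  have hI := posDef_information (C := C) hR hP
  have h1 : t⁻¹ • (P⁻¹ + Cᵀ * R⁻¹ * C) ≤ (t • P)⁻¹ + Cᵀ * R⁻¹ * C := by
    rw [inv_smul_of_posDef hP ht0, smul_add]
    refine add_le_add_right ?_ _
    have := smul_mono_left (transpose_mul_mul_posSemidef hR.inv.posSemidef C)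
      (inv_le_one_of_one_le₀ ht)
    rwa [one_smul] at this
  have h2 := inv_le_inv_of_le (hI.smul (inv_pos.2 ht0)) h1
  rwa [inv_smul_of_posDef hI (inv_pos.2 ht0), inv_inv] at h2

theorem posSemidef_riccati_sub (hR : R.PosDef) {P : Matrix (Fin n) (Fin n) ℝ} (hP : P.PosDef) :
    (riccatiMap A C Q R P - Q).PosSemidef := by
  rw [riccatiMap, add_sub_cancel_right]
  exact mul_mul_transpose_posSemidef (posDef_infoUpdate hR hP).posSemidef A

theorem le_riccatiMap (hR : R.PosDef) {P : Matrix (Fin n) (Fin n) ℝ} (hP : P.PosDef) :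
    Q ≤ riccatiMap A C Q R P :=
  Matrix.le_iff.2 (posSemidef_riccati_sub hR hP)

theorem posDef_riccatiMap (hQ : Q.PosDef) (hR : R.PosDef) {P : Matrix (Fin n) (Fin n) ℝ}
    (hP : P.PosDef) : (riccatiMap A C Q R P).PosDef :=
  posDef_of_le hQ (le_riccatiMap hR hP)

theorem riccatiMap_mono (hR : R.PosDef) {P P' : Matrix (Fin n) (Fin n) ℝ} (hP : P.PosDef)
    (h : P ≤ P') : riccatiMap A C Q R P ≤ riccatiMap A C Q R P' :=
  add_le_add_left (mul_mul_transpose_mono (infoUpdate_mono hR hP h) A) _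

/-- The slack (t - 1) Q, due to Q not being scaled, is the source of the contraction. -/
theorem riccatiMap_smul_le (hR : R.PosDef) {P : Matrix (Fin n) (Fin n) ℝ}
    (hP : P.PosDef) {t : ℝ} (ht : 1 ≤ t) :
    riccatiMap A C Q R (t • P) ≤ t • riccatiMap A C Q R P - (t - 1) • Q := by
  have h := mul_mul_transpose_mono (infoUpdate_smul_le (C := C) hR hP ht) A
  have h' := add_le_add_left h Q
  refine h'.trans_eq ?_
  rw [riccatiMap, smul_add, sub_smul, one_smul, Matrix.mul_smul, Matrix.smul_mul]
  abel

/-- The Riccati map contracts the order intervals `P ≤ t P'` towards `t = 1`. -/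
theorem riccatiMap_le_smul (hR : R.PosDef) {P P' : Matrix (Fin n) (Fin n) ℝ} (hP : P.PosDef)
    (hP' : P'.PosDef) {t c : ℝ} (ht : 1 ≤ t) (h : P ≤ t • P')
    (hc : c • riccatiMap A C Q R P' ≤ Q) :
    riccatiMap A C Q R P ≤ (1 + (1 - c) * (t - 1)) • riccatiMap A C Q R P' := by
  refine (riccatiMap_mono hR hP h).trans ((riccatiMap_smul_le hR hP' ht).trans ?_)
  -- The slack is worth at least (t - 1) c copies of the image of P', and t - (t - 1) c = 1 + (1 -
  -- c)(t - 1).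
  have h1 := smul_mono_right hc (sub_nonneg.2 ht)
  calc _ ≤ t • riccatiMap A C Q R P' - (t - 1) • c • riccatiMap A C Q R P' :=
        sub_le_sub_left h1 _
    _ = _ := by
        rw [smul_smul, ← sub_smul]
        congr 1; ring

/-- Completing the square in L: the right side exceeds the left by (L - L₀) S (L - L₀)ᵀ, where L₀ =
A P Cᵀ S⁻¹ is the optimal gain. -/
theorem riccatiMap_le_of_gain (hR : R.PosDef) {P : Matrix (Fin n) (Fin n) ℝ} (hP : P.PosDef)
    (L : Matrix (Fin n) (Fin p) ℝ) :
    riccatiMap A C Q R P ≤ (A - L * C) * P * (A - L * C)ᵀ + (L * R * Lᵀ + Q) := by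
  have hS := posDef_innovation (C := C) hR hP.posSemidef
  set S := C * P * Cᵀ + R with hSdef
  have hPt : Pᵀ = P := isHermitian_iff_isSymm.1 hP.isHermitian
  have hSt : S⁻¹ᵀ = S⁻¹ := isHermitian_iff_isSymm.1 hS.inv.isHermitian
  have hsq := mul_mul_transpose_posSemidef hS.posSemidef (L - A * P * Cᵀ * S⁻¹)
  rw [Matrix.le_iff]
  suffices hsuff : (A - L * C) * P * (A - L * C)ᵀ + (L * R * Lᵀ + Q) - riccatiMap A C Q R P
      = (L - A * P * Cᵀ * S⁻¹) * S * (L - A * P * Cᵀ * S⁻¹)ᵀ by rwa [hsuff]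
  have e1 : (L - A * P * Cᵀ * S⁻¹) * S = L * S - A * P * Cᵀ := by
    rw [Matrix.sub_mul, Matrix.mul_assoc _ S⁻¹ S, inv_mul_cancel_of_posDef hS, Matrix.mul_one]
  have e2 : (L - A * P * Cᵀ * S⁻¹)ᵀ = Lᵀ - S⁻¹ * C * P * Aᵀ := by
    simp only [transpose_sub, transpose_mul, transpose_transpose, hSt, hPt, Matrix.mul_assoc]
  have e3 : L * S * (S⁻¹ * C * P * Aᵀ) = L * C * P * Aᵀ := by
    calc _ = L * (S * S⁻¹) * C * P * Aᵀ := by simp only [Matrix.mul_assoc]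
      _ = _ := by rw [mul_inv_cancel_of_posDef hS, Matrix.mul_one]
  rw [e1, e2, Matrix.mul_sub, Matrix.sub_mul (L * S), Matrix.sub_mul (L * S), e3, riccatiMap,
    infoUpdate_eq hR hP, ← hSdef]
  have e4 : L * S * Lᵀ = L * C * P * Cᵀ * Lᵀ + L * R * Lᵀ := by
    rw [hSdef]; simp only [Matrix.mul_add, Matrix.add_mul, Matrix.mul_assoc]
  rw [e4]
  simp only [transpose_sub, transpose_mul, Matrix.mul_sub, Matrix.sub_mul, Matrix.mul_assoc]
  abel

/-- A Schur stable matrix admits a strict quadratic Lyapunov function. -/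
theorem exists_lyapunov {F : Matrix (Fin n) (Fin n) ℝ}
    (hF : Tendsto (fun k : ℕ => F ^ k) atTop (𝓝 0)) :
    ∃ X : Matrix (Fin n) (Fin n) ℝ, X.IsHermitian ∧ 1 ≤ X ∧
      F * X * Fᵀ + (1 / 2 : ℝ) • (1 : Matrix (Fin n) (Fin n) ℝ) ≤ X := by
  have hlim : Tendsto (fun k : ℕ => ∑ i, ∑ j, |(F ^ k * (F ^ k)ᵀ) i j|) atTop (𝓝 0) := by
    have hcont : Continuous fun M : Matrix (Fin n) (Fin n) ℝ => ∑ i, ∑ j, |(M * Mᵀ) i j| := by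
      fun_prop
    have := (hcont.tendsto 0).comp hF
    simpa [Function.comp_def] using this
  -- A truncated Gramian suffices: with X = ∑_{k<N} Fᵏ (Fᵏ)ᵀ one has F X Fᵀ + 1 = X + Fᴺ (Fᴺ)ᵀ, and
  -- N is taken so large that the remainder is at most 1/2. N ≥ 1 keeps the term k = 0, whence 1 ≤
  -- X.
  obtain ⟨N, hN, hN1⟩ := ((hlim.eventually_le_const (by norm_num : (0 : ℝ) < 1 / 2)).and
    (eventually_ge_atTop 1)).exists
  have hps : ∀ k, (F ^ k * (F ^ k)ᵀ).PosSemidef := fun k => by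
    simpa using posSemidef_self_mul_conjTranspose (F ^ k)
  have hX : ∀ N, F * (∑ k ∈ Finset.range N, F ^ k * (F ^ k)ᵀ) * Fᵀ + 1
      = (∑ k ∈ Finset.range N, F ^ k * (F ^ k)ᵀ) + F ^ N * (F ^ N)ᵀ := by
    intro N
    rw [← Finset.sum_range_succ, Finset.sum_range_succ', Matrix.mul_sum, Matrix.sum_mul]
    congr 1
    · refine Finset.sum_congr rfl fun k _ => ?_
      rw [pow_succ' F k, transpose_mul]
      simp only [Matrix.mul_assoc]
    · simp
  refine ⟨∑ k ∈ Finset.range N, F ^ k * (F ^ k)ᵀ,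
    (posSemidef_sum _ fun k _ => hps k).isHermitian, ?_, ?_⟩
  · obtain ⟨N', rfl⟩ : ∃ N', N = N' + 1 := ⟨N - 1, by omega⟩
    rw [Finset.sum_range_succ', Matrix.le_iff]
    have := posSemidef_sum (Finset.range N') fun k _ => hps (k + 1)
    simpa using this
  · have h1 : F ^ N * (F ^ N)ᵀ ≤ (1 / 2 : ℝ) • (1 : Matrix (Fin n) (Fin n) ℝ) :=
      (le_sum_abs_smul_one (hps N).isHermitian).trans (smul_mono_left PosSemidef.one hN)
    have h2 := hX N
    have h3 : (1 : Matrix (Fin n) (Fin n) ℝ) = (1 / 2 : ℝ) • 1 + (1 / 2 : ℝ) • 1 := by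
      rw [← add_smul]; norm_num
    rw [eq_sub_of_add_eq h2, sub_add, sub_eq_add_neg, neg_sub]
    nth_rewrite 2 [h3]
    rw [add_assoc, sub_add_cancel_right, ← sub_eq_add_neg]
    nth_rewrite 2 [← add_zero (∑ k ∈ Finset.range N, F ^ k * (F ^ k)ᵀ)]
    exact add_le_add_right (sub_nonpos.2 h1) _

/-- Detectability bounds the Riccati recursion. -/
theorem exists_riccati_bound (hQ : Q.PosDef) (hR : R.PosDef) (hAC : Detectable A C)
    {P : ℕ → Matrix (Fin n) (Fin n) ℝ} (hP0 : (P 0).PosDef)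
    (hstep : ∀ k, (P k).PosDef → P (k + 1) = riccatiMap A C Q R (P k)) :
    ∃ M : ℝ, 1 ≤ M ∧ ∀ k, (P k).PosDef ∧ P k ≤ M • (1 : Matrix (Fin n) (Fin n) ℝ) := by
  obtain ⟨L, hL⟩ := hAC
  obtain ⟨X, hXh, hX1, hX⟩ :=
    exists_lyapunov (tendsto_pow_matrix_of_forall_spectrum_norm_lt_one _ hL)
  set F := A - L * C
  set S := L * R * Lᵀ + Q
  have hS : S.IsHermitian :=
    ((mul_mul_transpose_posSemidef hR.posSemidef L).add hQ.posSemidef).isHermitian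
  set a := ∑ i, ∑ j, |S i j| with ha
  set b := ∑ i, ∑ j, |P 0 i j| with hb
  have ha0 : 0 ≤ a := Finset.sum_nonneg fun i _ => Finset.sum_nonneg fun j _ => abs_nonneg _
  have hb0 : 0 ≤ b := Finset.sum_nonneg fun i _ => Finset.sum_nonneg fun j _ => abs_nonneg _
  -- b covers the initial value P 0 ≤ b I, and a ≤ m / 2 lets the constant term S ≤ a I fit into the
  -- margin m / 2 of m X.
  set m := 2 * a + b with hm
  have hm0 : 0 ≤ m := by positivity
  have key : ∀ k, (P k).PosDef ∧ P k ≤ m • X := by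
    intro k
    induction k with
    | zero =>
      refine ⟨hP0, (le_sum_abs_smul_one hP0.isHermitian).trans ?_⟩
      exact (smul_mono_left PosSemidef.one (by linarith : b ≤ m)).trans (smul_mono_right hX1 hm0)
    | succ k ih =>
      rw [hstep k ih.1]
      refine ⟨posDef_riccatiMap hQ hR ih.1, (riccatiMap_le_of_gain hR ih.1 L).trans ?_⟩
      calc F * P k * Fᵀ + S ≤ F * (m • X) * Fᵀ + (m / 2) • (1 : Matrix (Fin n) (Fin n) ℝ) :=
            add_le_add (mul_mul_transpose_mono ih.2 F)
              ((le_sum_abs_smul_one hS).trans (smul_mono_left PosSemidef.one (by linarith)))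
        _ = m • (F * X * Fᵀ + (1 / 2 : ℝ) • (1 : Matrix (Fin n) (Fin n) ℝ)) := by
            rw [smul_add, smul_smul, Matrix.mul_smul, Matrix.smul_mul]
            congr 2; ring
        _ ≤ m • X := smul_mono_right hX hm0
  refine ⟨m * (∑ i, ∑ j, |X i j|) + 1, ?_, fun k => ⟨(key k).1, (key k).2.trans ?_⟩⟩
  · have : 0 ≤ ∑ i, ∑ j, |X i j| :=
      Finset.sum_nonneg fun i _ => Finset.sum_nonneg fun j _ => abs_nonneg _
    nlinarith [mul_nonneg hm0 this]
  · refine (smul_mono_right (le_sum_abs_smul_one hXh) hm0).trans ?_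
    rw [smul_smul]
    exact smul_mono_left PosSemidef.one (by linarith)

/-- A positive definite matrix dominates a positive multiple of the identity. -/
theorem exists_smul_one_le {M : Matrix (Fin n) (Fin n) ℝ} (hM : M.PosDef) :
    ∃ c : ℝ, 0 < c ∧ c • (1 : Matrix (Fin n) (Fin n) ℝ) ≤ M := by
  rcases Nat.eq_zero_or_pos n with rfl | hn
  · exact ⟨1, one_pos, (Subsingleton.elim _ _).le⟩
  · exact ⟨lamMin M, lamMin_pos hn hM, lamMin_smul_one_le hM.isHermitian⟩

theorem posSemidef_of_tendsto {P : ℕ → Matrix (Fin n) (Fin n) ℝ} {L : Matrix (Fin n) (Fin n) ℝ}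
    (h : Tendsto P atTop (𝓝 L)) (hP : ∀ᶠ k in atTop, (P k).PosSemidef) : L.PosSemidef := by
  rw [posSemidef_iff_form]
  constructor
  · have h1 : Tendsto (fun k => (P k)ᴴ) atTop (𝓝 Lᴴ) :=
      ((continuous_id.matrix_conjTranspose).tendsto L).comp h
    refine tendsto_nhds_unique (h1.congr' ?_) h
    filter_upwards [hP] with k hk using hk.isHermitian
  · intro x
    have hc : Continuous fun M : Matrix (Fin n) (Fin n) ℝ => x ⬝ᵥ (M *ᵥ x) := by fun_prop
    refine ge_of_tendsto ((hc.tendsto L).comp h) ?_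
    filter_upwards [hP] with k hk using form_nonneg hk x

/-- Convergence of the Riccati recursion under detectability. -/
theorem exists_tendsto_riccati (hQ : Q.PosDef) (hR : R.PosDef) (hAC : Detectable A C)
    {P : ℕ → Matrix (Fin n) (Fin n) ℝ} (hP0 : (P 0).PosDef)
    (hstep : ∀ k, (P k).PosDef → P (k + 1) = riccatiMap A C Q R (P k)) :
    ∃ L : Matrix (Fin n) (Fin n) ℝ, L.PosDef ∧ Tendsto P atTop (𝓝 L) := by
  obtain ⟨M, hM1, hM⟩ := exists_riccati_bound hQ hR hAC hP0 hstep
  obtain ⟨q, hq0, hq⟩ := exists_smul_one_le hQ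
  have hst : ∀ k, P (k + 1) = riccatiMap A C Q R (P k) := fun k => hstep k (hM k).1
  have hQP : ∀ k, Q ≤ P (k + 1) := fun k => hst k ▸ le_riccatiMap hR (hM k).1
  have hM0 : 0 < M := by linarith
  -- c makes c P k ≤ Q uniformly in k; the cap at 1 keeps 1 - c in [0, 1).
  set c := min (q / M) 1 with hc
  have hc0 : 0 < c := lt_min (div_pos hq0 hM0) one_pos
  have hc1 : c ≤ 1 := min_le_right _ _
  have hcQ : ∀ k, c • P k ≤ Q := fun k => by
    refine (smul_mono_right (hM k).2 hc0.le).trans ((?_ : _ ≤ _).trans hq)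
    rw [smul_smul]
    refine smul_mono_left PosSemidef.one ?_
    calc c * M ≤ q / M * M := by gcongr; exact min_le_left _ _
      _ = q := by field_simp
  set τ := c⁻¹ - 1 with hτ
  have hτ0 : 0 ≤ τ := sub_nonneg.2 ((one_le_inv₀ hc0).2 hc1)
  -- From index 1 on, c P ≤ Q ≤ P' for any two terms, so their ratio is at most c⁻¹ = 1 + τ; each
  -- further step shrinks the excess by 1 - c.
  have hcomp : ∀ i j k, P (i + j + 1) ≤ (1 + (1 - c) ^ i * τ) • P (i + k + 1) := by
    intro i
    induction i with
    | zero =>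
      intro j k
      have h1 := smul_mono_right ((hcQ (0 + j + 1)).trans (hQP (0 + k))) (inv_pos.2 hc0).le
      rw [smul_smul, inv_mul_cancel₀ hc0.ne', one_smul] at h1
      simpa [hτ] using h1
    | succ i ih =>
      intro j k
      have e : ∀ l, P (i + 1 + l + 1) = riccatiMap A C Q R (P (i + l + 1)) := fun l => by
        rw [← hst]; congr 1; omega
      have := riccatiMap_le_smul (A := A) (C := C) (Q := Q) hR (hM _).1 (hM _).1
        (by nlinarith [mul_nonneg (pow_nonneg (sub_nonneg.2 hc1) i) hτ0]) (ih j k)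
        (c := c) (by rw [← e]; exact hcQ _)
      rw [e, e]
      refine this.trans_eq ?_
      congr 1; ring
  have hdiff : ∀ i j k, P (i + j + 1) - P (i + k + 1)
      ≤ ((1 - c) ^ i * τ * M) • (1 : Matrix (Fin n) (Fin n) ℝ) := by
    intro i j k
    have h0 : 0 ≤ (1 - c) ^ i * τ := mul_nonneg (pow_nonneg (sub_nonneg.2 hc1) i) hτ0
    rw [sub_le_iff_le_add]
    refine (hcomp i j k).trans ?_
    rw [add_smul, one_smul, add_comm, ← smul_smul ((1 - c) ^ i * τ)]
    exact add_le_add_left (smul_mono_right (hM _).2 h0) _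
  -- Exchanging j and k in `hdiff` gives the two-sided bound, hence a uniform Cauchy estimate for
  -- each entry.
  have hent : ∀ i j k a b, |P (i + j + 1) a b - P (i + k + 1) a b| ≤ (1 - c) ^ i * τ * M := by
    intro i j k a b
    refine abs_apply_le_of_le (M := P (i + j + 1) - P (i + k + 1)) (hdiff i j k) ?_
      ((hM _).1.isHermitian.sub (hM _).1.isHermitian) a b
    rw [neg_le, neg_sub]
    exact hdiff i k j
  have hlim0 : Tendsto (fun i : ℕ => (1 - c) ^ i * τ * M) atTop (𝓝 0) := by
    have := ((tendsto_pow_atTop_nhds_zero_of_lt_one (sub_nonneg.2 hc1)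
      (by linarith : 1 - c < 1)).mul_const τ).mul_const M
    simpa using this
  have hentry : ∀ a b, ∃ l, Tendsto (fun k => P k a b) atTop (𝓝 l) := by
    intro a b
    refine cauchySeq_tendsto_of_complete (Metric.cauchySeq_iff.2 fun δ hδ => ?_)
    obtain ⟨i, hi⟩ := (hlim0.eventually_lt_const hδ).exists
    refine ⟨i + 1, fun r hr s hs => ?_⟩
    obtain ⟨j, rfl⟩ := Nat.exists_eq_add_of_le hr
    obtain ⟨k, rfl⟩ := Nat.exists_eq_add_of_le hs
    rw [Real.dist_eq]
    have := hent i j k a b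
    rw [add_right_comm i 1 j, add_right_comm i 1 k]
    linarith
  choose l hl using hentry
  have hlim : Tendsto P atTop (𝓝 (Matrix.of l)) :=
    tendsto_pi_nhds.2 fun a => tendsto_pi_nhds.2 fun b => hl a b
  refine ⟨Matrix.of l, ?_, hlim⟩
  refine posDef_of_le hQ (Matrix.le_iff.2 (posSemidef_of_tendsto (hlim.sub_const Q) ?_))
  filter_upwards [eventually_ge_atTop 1] with k hk
  obtain ⟨k, rfl⟩ := Nat.exists_eq_add_of_le' hk
  exact Matrix.le_iff.1 (hQP k)

theorem tendsto_inv_of_posDef {P : ℕ → Matrix (Fin n) (Fin n) ℝ} {L : Matrix (Fin n) (Fin n) ℝ}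
    (h : Tendsto P atTop (𝓝 L)) (hL : L.PosDef) :
    Tendsto (fun k => (P k)⁻¹) atTop (𝓝 L⁻¹) := by
  have hd : L.det ≠ 0 := ((isUnit_iff_isUnit_det _).1 hL.isUnit).ne_zero
  have hdet : Tendsto (fun k => (P k).det) atTop (𝓝 L.det) :=
    ((continuous_id.matrix_det).tendsto L).comp h
  have hadj : Tendsto (fun k => (P k).adjugate) atTop (𝓝 L.adjugate) :=
    ((continuous_id.matrix_adjugate).tendsto L).comp h
  simp only [Matrix.inv_def, Ring.inverse_eq_inv']
  exact (hdet.inv₀ hd).smul hadj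

/-- A limit of the Riccati recursion solves the algebraic Riccati equation. -/
theorem isRiccatiSolution_of_tendsto (hR : R.PosDef)
    {P : ℕ → Matrix (Fin n) (Fin n) ℝ} {L : Matrix (Fin n) (Fin n) ℝ}
    (hP : ∀ k, (P k).PosDef) (hstep : ∀ k, P (k + 1) = riccatiMap A C Q R (P k))
    (hL : L.PosDef) (h : Tendsto P atTop (𝓝 L)) : IsRiccatiSolution A C Q R L := by
  have hS := posDef_innovation (C := C) hR hL.posSemidef
  have h1 : Tendsto (fun k => C * P k * Cᵀ + R) atTop (𝓝 (C * L * Cᵀ + R)) :=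
    (((continuous_const.matrix_mul continuous_id).matrix_mul continuous_const).add
      continuous_const).tendsto L |>.comp h
  have h2 := tendsto_inv_of_posDef h1 hS
  have hc : Continuous fun z : Matrix (Fin n) (Fin n) ℝ × Matrix (Fin p) (Fin p) ℝ =>
      A * (z.1 - z.1 * Cᵀ * z.2 * C * z.1) * Aᵀ + Q := by fun_prop
  have h3 := (hc.tendsto (L, (C * L * Cᵀ + R)⁻¹)).comp (h.prodMk_nhds h2)
  have h4 : Tendsto (fun k => P (k + 1)) atTop (𝓝 L) := h.comp (tendsto_add_atTop_nat 1)
  have h5 := tendsto_nhds_unique (h4.congr fun k => ?_) h3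
  · rw [IsRiccatiSolution]
    nth_rewrite 1 [h5]
    simp only [Matrix.mul_sub, Matrix.sub_mul, Matrix.mul_assoc]
    abel
  · rw [hstep k, riccatiMap, infoUpdate_eq hR (hP k)]
    rfl

end Riccati

/-! ### The filter covariances as an orbit of the Riccati map. -/

section Covariance

variable {n p : ℕ} {A : Matrix (Fin n) (Fin n) ℝ} {C : Matrix (Fin p) (Fin n) ℝ}
  {Q : Matrix (Fin n) (Fin n) ℝ} {R : Matrix (Fin p) (Fin p) ℝ}
  {Pp Pu : ℕ → Matrix (Fin n) (Fin n) ℝ} {K : ℕ → Matrix (Fin n) (Fin p) ℝ}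

theorem IsCovariance.update_eq (hR : R.PosDef) (h : IsCovariance A C Q R Pp Pu K) {k : ℕ}
    (hk : (Pp k).PosDef) : Pu k = infoUpdate C R (Pp k) := by
  have hS := posDef_innovation (C := C) hR hk.posSemidef
  have hPt : (Pp k)ᵀ = Pp k := isHermitian_iff_isSymm.1 hk.isHermitian
  have hSt : (C * Pp k * Cᵀ + R)⁻¹ᵀ = (C * Pp k * Cᵀ + R)⁻¹ :=
    isHermitian_iff_isSymm.1 hS.inv.isHermitian
  rw [infoUpdate_eq hR hk, h.update, h.gain]
  congr 1
  rw [Matrix.mul_assoc (Pp k * Cᵀ), inv_mul_cancel_of_posDef hS, Matrix.mul_one,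
    transpose_mul, transpose_mul, hSt, hPt, transpose_transpose]
  simp only [Matrix.mul_assoc]

theorem IsCovariance.predict_eq (hR : R.PosDef) (h : IsCovariance A C Q R Pp Pu K) {k : ℕ}
    (hk : (Pp k).PosDef) : Pp (k + 1) = riccatiMap A C Q R (Pp k) := by
  rw [h.predict, h.update_eq hR hk, riccatiMap]

theorem IsCovariance.posDef_predict (hQ : Q.PosDef) (hR : R.PosDef)
    (h : IsCovariance A C Q R Pp Pu K) (k : ℕ) : (Pp k).PosDef := by
  induction k with
  | zero => exact h.init
  | succ k ih => rw [h.predict_eq hR ih]; exact posDef_riccatiMap hQ hR ih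

theorem IsCovariance.posDef_update (hQ : Q.PosDef) (hR : R.PosDef)
    (h : IsCovariance A C Q R Pp Pu K) (k : ℕ) : (Pu k).PosDef := by
  rw [h.update_eq hR (h.posDef_predict hQ hR k)]
  exact posDef_infoUpdate hR (h.posDef_predict hQ hR k)

theorem IsCovariance.inv_update (hQ : Q.PosDef) (hR : R.PosDef)
    (h : IsCovariance A C Q R Pp Pu K) (k : ℕ) : (Pu k)⁻¹ = (Pp k)⁻¹ + Cᵀ * R⁻¹ * C := by
  rw [h.update_eq hR (h.posDef_predict hQ hR k), inv_infoUpdate hR (h.posDef_predict hQ hR k)]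

theorem IsCovariance.gain_eq (hQ : Q.PosDef) (hR : R.PosDef)
    (h : IsCovariance A C Q R Pp Pu K) (k : ℕ) : K k = Pu k * Cᵀ * R⁻¹ := by
  rw [h.gain, h.update_eq hR (h.posDef_predict hQ hR k),
    gain_eq_infoUpdate hR (h.posDef_predict hQ hR k)]

theorem IsCovariance.exists_inv_update_le (hQ : Q.PosDef) (hR : R.PosDef)
    (h : IsCovariance A C Q R Pp Pu K) :
    ∃ eps : ℝ, ∀ k, LoewnerLE (Pu k)⁻¹ (eps • 1) := by
  have hH : (Cᵀ * R⁻¹ * C).PosSemidef := transpose_mul_mul_posSemidef hR.inv.posSemidef C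
  set H := Cᵀ * R⁻¹ * C with hHdef
  -- The first summand serves k = 0; the second serves k ≥ 1, where Q ≤ Pp k.
  set B := (Pp 0)⁻¹ + Q⁻¹ + H with hB
  have hBh : B.IsHermitian :=
    ((h.init.inv.add hQ.inv).add_posSemidef hH).isHermitian
  refine ⟨∑ i, ∑ j, |B i j|, fun k => Matrix.le_iff.1
    ((?_ : (Pu k)⁻¹ ≤ B).trans (le_sum_abs_smul_one hBh))⟩
  rw [h.inv_update hQ hR, hB]
  refine add_le_add_left ?_ H
  cases k with
  | zero => rw [Matrix.le_iff, add_sub_cancel_left]; exact hQ.inv.posSemidef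
  | succ k =>
    have h1 : (Pp (k + 1))⁻¹ ≤ Q⁻¹ := by
      refine inv_le_inv_of_le hQ ?_
      rw [h.predict_eq hR (h.posDef_predict hQ hR k)]
      exact le_riccatiMap hR (h.posDef_predict hQ hR k)
    refine h1.trans ?_
    rw [Matrix.le_iff, add_sub_cancel_right]
    exact h.init.inv.posSemidef

end Covariance

/-! ### The prediction step and the matrix Q̄. -/

section Prediction

variable {n : ℕ} {A Q P : Matrix (Fin n) (Fin n) ℝ} {eps : ℝ}

theorem information_le (hP : P⁻¹ ≤ eps • (1 : Matrix (Fin n) (Fin n) ℝ)) :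
    P⁻¹ + Aᵀ * Q⁻¹ * A ≤ eps • (1 : Matrix (Fin n) (Fin n) ℝ) + Aᵀ * Q⁻¹ * A :=
  add_le_add_left hP _

theorem Qbar_posSemidef (hQ : Q.PosDef) (hPd : P.PosDef)
    (hP : P⁻¹ ≤ eps • (1 : Matrix (Fin n) (Fin n) ℝ)) : (Qbar A Q eps).PosSemidef :=
  (posDef_of_le (posDef_information (C := A) hQ hPd) (information_le hP)).inv.posSemidef

/-- `infoUpdate` is reused with (A, Q) in place of (C, R); replacing P⁻¹ by its bound ϵ I turns it
into the time-independent `Qbar`. -/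
theorem Qbar_le_infoUpdate (hQ : Q.PosDef) (hPd : P.PosDef)
    (hP : P⁻¹ ≤ eps • (1 : Matrix (Fin n) (Fin n) ℝ)) : Qbar A Q eps ≤ infoUpdate A Q P :=
  inv_le_inv_of_le (posDef_information hQ hPd) (information_le hP)

theorem Qbar_le (hQ : Q.PosDef) (hPd : P.PosDef)
    (hP : P⁻¹ ≤ eps • (1 : Matrix (Fin n) (Fin n) ℝ)) : Qbar A Q eps ≤ P :=
  (Qbar_le_infoUpdate hQ hPd hP).trans (infoUpdate_le hQ hPd)

/-- The matrix inversion lemma for the predicted covariance. -/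
theorem transpose_mul_inv_mul_eq (hQ : Q.PosDef) (hPd : P.PosDef) :
    Aᵀ * (A * P * Aᵀ + Q)⁻¹ * A = P⁻¹ - P⁻¹ * infoUpdate A Q P * P⁻¹ := by
  have hN := posDef_information (C := A) hQ hPd
  rw [add_comm, add_mul_mul_inv_eq_sub _ _ _ _ hQ.isUnit hPd.isUnit hN.isUnit, infoUpdate]
  set N := P⁻¹ + Aᵀ * Q⁻¹ * A with hNdef
  have e : Aᵀ * Q⁻¹ * A = N - P⁻¹ := by rw [hNdef, add_sub_cancel_left]
  calc Aᵀ * (Q⁻¹ - Q⁻¹ * A * N⁻¹ * Aᵀ * Q⁻¹) * A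
      = Aᵀ * Q⁻¹ * A - (Aᵀ * Q⁻¹ * A) * N⁻¹ * (Aᵀ * Q⁻¹ * A) := by
        simp only [Matrix.mul_sub, Matrix.sub_mul, Matrix.mul_assoc]
    _ = _ := by
        rw [e, Matrix.sub_mul, mul_inv_cancel_of_posDef hN, Matrix.mul_sub, Matrix.sub_mul,
          Matrix.sub_mul, Matrix.one_mul, Matrix.one_mul, Matrix.mul_assoc P⁻¹ N⁻¹ N,
          inv_mul_cancel_of_posDef hN, Matrix.mul_one]
        abel

theorem form_predict_le (hQ : Q.PosDef) (hPd : P.PosDef)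
    (hP : P⁻¹ ≤ eps • (1 : Matrix (Fin n) (Fin n) ℝ)) (v : Fin n → ℝ) :
    (A *ᵥ v) ⬝ᵥ ((A * P * Aᵀ + Q)⁻¹ *ᵥ (A *ᵥ v))
      ≤ v ⬝ᵥ ((P⁻¹ - P⁻¹ * Qbar A Q eps * P⁻¹) *ᵥ v) := by
  have ht : P⁻¹ᵀ = P⁻¹ := isHermitian_iff_isSymm.1 hPd.inv.isHermitian
  have h1 : Aᵀ * (A * P * Aᵀ + Q)⁻¹ * A ≤ P⁻¹ - P⁻¹ * Qbar A Q eps * P⁻¹ := by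
    rw [transpose_mul_inv_mul_eq hQ hPd]
    have := mul_mul_transpose_mono (Qbar_le_infoUpdate (A := A) hQ hPd hP) P⁻¹
    rw [ht] at this
    exact sub_le_sub_left this _
  refine le_trans (le_of_eq ?_) (form_le_of_le h1 v)
  rw [← mulVec_mulVec, ← mulVec_mulVec, dotProduct_transpose_mulVec]

end Prediction

/-- Sector condition: sat(r) lies between 0 and r, so sat(r) and sat(r) - r have opposite signs,
whatever the saturation level. -/
theorem sat_mul_sat_sub_nonpos {b : ℝ} (hb : 0 ≤ b) (r : ℝ) : (sat b r - r) * sat b r ≤ 0 := by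
  unfold sat
  rcases le_total b r with h | h
  · rw [min_eq_left h, max_eq_right (by linarith)]
    nlinarith
  · rw [min_eq_right h]
    rcases le_total (-b) r with h' | h'
    · rw [max_eq_right h']; simp
    · rw [max_eq_left h']; nlinarith

/-! ### The algebraic identity behind the linear matrix inequality. -/

section LyapunovStep

variable {n p m : ℕ} {C : Matrix (Fin p) (Fin n) ℝ} {D : Matrix (Fin p) (Fin m) ℝ}
  {R G2 W : Matrix (Fin p) (Fin p) ℝ} {Qb Pu Pp : Matrix (Fin n) (Fin n) ℝ}
  {U : Matrix (Fin m) (Fin m) ℝ} {α : ℝ}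

theorem form_fromBlocks_fromBlocks {n₁ n₂ n₃ : Type*} [Fintype n₁] [Fintype n₂] [Fintype n₃]
    (Z11 : Matrix n₁ n₁ ℝ) (Z12 : Matrix n₁ n₂ ℝ) (Z13 : Matrix n₁ n₃ ℝ) (Z22 : Matrix n₂ n₂ ℝ)
    (Z23 : Matrix n₂ n₃ ℝ) (Z33 : Matrix n₃ n₃ ℝ) (e : n₁ → ℝ) (q : n₂ → ℝ) (d : n₃ → ℝ) :
    Sum.elim e (Sum.elim q d) ⬝ᵥ ((fromBlocks Z11 (fromCols Z12 Z13) (fromCols Z12 Z13)ᵀ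
      (fromBlocks Z22 Z23 Z23ᵀ Z33)) *ᵥ Sum.elim e (Sum.elim q d))
      = e ⬝ᵥ (Z11 *ᵥ e) + 2 * (e ⬝ᵥ (Z12 *ᵥ q)) + 2 * (e ⬝ᵥ (Z13 *ᵥ d)) + q ⬝ᵥ (Z22 *ᵥ q)
        + 2 * (q ⬝ᵥ (Z23 *ᵥ d)) + d ⬝ᵥ (Z33 *ᵥ d) := by
  have h1 : q ⬝ᵥ (Z12ᵀ *ᵥ e) = e ⬝ᵥ (Z12 *ᵥ q) := by
    rw [dotProduct_mulVec, vecMul_transpose, dotProduct_comm]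
  have h2 : d ⬝ᵥ (Z13ᵀ *ᵥ e) = e ⬝ᵥ (Z13 *ᵥ d) := by
    rw [dotProduct_mulVec, vecMul_transpose, dotProduct_comm]
  have h3 : d ⬝ᵥ (Z23ᵀ *ᵥ q) = q ⬝ᵥ (Z23 *ᵥ d) := by
    rw [dotProduct_mulVec, vecMul_transpose, dotProduct_comm]
  rw [transpose_fromCols, fromBlocks_mulVec]
  simp only [Sum.elim_comp_inl, Sum.elim_comp_inr, fromCols_mulVec, fromRows_mulVec,
    fromBlocks_mulVec, sumElim_dotProduct_sumElim, dotProduct_add, h1, h2, h3]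
  ring

/-- The quadratic form of `Z_k`, at the error, the dead zone and the outlier, expressed through
the Lyapunov decrease. -/
theorem form_Z_eq (hR : R.PosDef) (hG2 : G2.IsHermitian) (hW : W.IsHermitian)
    (hPu : Pu.PosDef) (hQb : Qb.IsHermitian) (hinv : Pu⁻¹ = Pp⁻¹ + Cᵀ * R⁻¹ * C)
    (e : Fin n → ℝ) (d : Fin m → ℝ) (r s : Fin p → ℝ) (hr : r = D *ᵥ d - C *ᵥ e) :
    let v := e + (Pu * Cᵀ * R⁻¹) *ᵥ s
    let z := Sum.elim e (Sum.elim (s - r) d)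
    v ⬝ᵥ ((Pu⁻¹ - Pu⁻¹ * Qb * Pu⁻¹) *ᵥ v) + r ⬝ᵥ (G2 *ᵥ r) + z ⬝ᵥ (Z C D R G2 Qb Pu Pp W U α *ᵥ z)
      = (1 - α) * (e ⬝ᵥ (Pp⁻¹ *ᵥ e)) + d ⬝ᵥ ((T6 C D R G2 Qb Pu + U) *ᵥ d)
        + 2 * ((s - r) ⬝ᵥ (W *ᵥ s)) := by
  intro v z
  have hPi : Pu⁻¹ᵀ = Pu⁻¹ := isHermitian_iff_isSymm.1 hPu.inv.isHermitian
  have hPut : Puᵀ = Pu := isHermitian_iff_isSymm.1 hPu.isHermitian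
  have hRi : R⁻¹ᵀ = R⁻¹ := isHermitian_iff_isSymm.1 hR.inv.isHermitian
  have hQbt : Qbᵀ = Qb := isHermitian_iff_isSymm.1 hQb
  set G := R⁻¹ * C * (Pu - Qb) * Cᵀ * R⁻¹ with hG
  set B := Cᵀ * R⁻¹ - Pu⁻¹ * Qb * Cᵀ * R⁻¹ with hB
  have hGh : G.IsHermitian := by
    rw [isHermitian_iff_isSymm, IsSymm, hG]
    simp only [transpose_mul, transpose_sub, transpose_transpose, hRi, hPut, hQbt,
      Matrix.mul_assoc]
  set N := Pu⁻¹ - Pu⁻¹ * Qb * Pu⁻¹ with hN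
  have hNh : N.IsHermitian := by
    rw [isHermitian_iff_isSymm, IsSymm, hN]
    simp only [transpose_mul, transpose_sub, hPi, hQbt, Matrix.mul_assoc]
  have hNK : N * (Pu * Cᵀ * R⁻¹) = B := by
    have : N * Pu = 1 - Pu⁻¹ * Qb := by
      rw [hN, Matrix.sub_mul, Matrix.mul_assoc _ Pu⁻¹ Pu, inv_mul_cancel_of_posDef hPu,
        Matrix.mul_one]
    rw [hB, ← Matrix.mul_assoc, ← Matrix.mul_assoc, this]
    simp only [Matrix.sub_mul, Matrix.one_mul]
  have hKNK : (Pu * Cᵀ * R⁻¹)ᵀ * B = G := by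
    rw [hB, hG]
    simp only [transpose_mul, transpose_transpose, hRi, hPut, Matrix.mul_sub, Matrix.sub_mul,
      Matrix.mul_assoc]
    congr 3
    rw [← Matrix.mul_assoc Pu, mul_inv_cancel_of_posDef hPu, Matrix.one_mul]
  -- With K = Pu Cᵀ R⁻¹, the relations N K = B and Kᵀ B = G remove the gain from the expansion of
  -- the form at e + K s.
  have hv : v ⬝ᵥ (N *ᵥ v) = e ⬝ᵥ (N *ᵥ e) + 2 * (e ⬝ᵥ (B *ᵥ s)) + s ⬝ᵥ (G *ᵥ s) := by
    have h1 : ((Pu * Cᵀ * R⁻¹) *ᵥ s) ⬝ᵥ (N *ᵥ e) = e ⬝ᵥ (B *ᵥ s) := by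
      rw [dotProduct_mulVec_comm_of_isHermitian hNh, mulVec_mulVec, hNK]
    have h2 : ((Pu * Cᵀ * R⁻¹) *ᵥ s) ⬝ᵥ (N *ᵥ ((Pu * Cᵀ * R⁻¹) *ᵥ s)) = s ⬝ᵥ (G *ᵥ s) := by
      rw [mulVec_mulVec, hNK, ← dotProduct_transpose_mulVec, mulVec_mulVec, hKNK]
    simp only [v, mulVec_add, dotProduct_add, add_dotProduct, h1, h2]
    rw [mulVec_mulVec, hNK]
    ring
  have hT1 : T1 C R G2 Qb Pu = B * C + (B * C)ᵀ - Cᵀ * R⁻¹ * C + Pu⁻¹ * Qb * Pu⁻¹ - Cᵀ * G * C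
      - Cᵀ * G2 * C := by
    rw [T1, hB, hG]
    simp only [transpose_mul, transpose_sub, transpose_transpose, hRi, hPi, hQbt,
      Matrix.sub_mul, Matrix.mul_assoc]
    abel
  have hT2 : T2 C R Qb Pu = Cᵀ * G - B := by
    rw [T2, hB, hG]
    simp only [Matrix.mul_assoc]
    abel
  have hT3 : T3 C D R G2 Qb Pu = (Cᵀ * G - B + Cᵀ * G2) * D := by
    rw [← hT2]; rfl
  have hT4 : T4 C R Qb Pu = -G := rfl
  have hT5 : T5 C D R Qb Pu = -G * D := rfl
  have hT6 : T6 C D R G2 Qb Pu = Dᵀ * (G + G2) * D := rfl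
  have hz : z ⬝ᵥ (Z C D R G2 Qb Pu Pp W U α *ᵥ z) = _ := form_fromBlocks_fromBlocks _ _ _ _ _ _ _ _ _
  have hNe : N = Pp⁻¹ + Cᵀ * R⁻¹ * C - Pu⁻¹ * Qb * Pu⁻¹ := by rw [hN, ← hinv]
  rw [hv, hz, hT1, hT2, hT3, hT4, hT5, hT6, hNe]
  -- In the dead zone q = s - r, the W entries of Z contribute 2 qᵀ W (q + D d - C e) = 2 qᵀ W s.
  obtain ⟨q, rfl⟩ : ∃ q, s = q + r := ⟨s - r, by simp⟩
  have hBt : e ⬝ᵥ ((B * C)ᵀ *ᵥ e) = e ⬝ᵥ (B *ᵥ (C *ᵥ e)) := by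
    rw [dotProduct_transpose_mulVec, dotProduct_comm, mulVec_mulVec]
  rw [hr, add_sub_cancel_right]
  simp only [add_mulVec, sub_mulVec, neg_mulVec, smul_mulVec, mulVec_add, mulVec_sub,
    dotProduct_add, dotProduct_sub, add_dotProduct, sub_dotProduct, dotProduct_neg, dotProduct_smul,
    smul_eq_mul, hBt, Matrix.add_mul, Matrix.sub_mul, Matrix.neg_mul, ← mulVec_mulVec,
    dotProduct_transpose_mulVec]
  -- Symmetry of G, G2 and W puts each bilinear term in one order, after which the identity is
  -- linear in them.
  have g1 := dotProduct_mulVec_comm_of_isHermitian hGh (D *ᵥ d) (C *ᵥ e)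
  have g2 := dotProduct_mulVec_comm_of_isHermitian hGh q (C *ᵥ e)
  have g3 := dotProduct_mulVec_comm_of_isHermitian hGh q (D *ᵥ d)
  have g4 := dotProduct_mulVec_comm_of_isHermitian hG2 (D *ᵥ d) (C *ᵥ e)
  have g5 := dotProduct_mulVec_comm_of_isHermitian hW q (C *ᵥ e)
  simp only [g1, g2, g3, g4, g5]
  ring

end LyapunovStep

theorem le_of_linear_recursion {V : ℕ → ℝ} {α β : ℝ} (hα : 0 < α) (hα1 : α ≤ 1)
    (h : ∀ k, V (k + 1) ≤ (1 - α) * V k + β) (k : ℕ) :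
    V k ≤ (1 - α) ^ k * V 0 + (1 - (1 - α) ^ k) / α * β := by
  induction k with
  | zero => simp
  | succ k ih =>
    refine (h k).trans ?_
    have := mul_le_mul_of_nonneg_left ih (sub_nonneg.2 hα1)
    calc (1 - α) * V k + β
        ≤ (1 - α) * ((1 - α) ^ k * V 0 + (1 - (1 - α) ^ k) / α * β) + β := by linarith
      _ = _ := by field_simp; ring

/-! ### From Lyapunov decrease to norm bounds. -/

section ErrorBounds

variable {n : ℕ} {P : ℕ → Matrix (Fin n) (Fin n) ℝ} {L : Matrix (Fin n) (Fin n) ℝ}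
  {e : ℕ → Fin n → ℝ}

theorem enorm2_le_sqrt (hn : 0 < n) {M : Matrix (Fin n) (Fin n) ℝ} (hM : M.PosDef)
    {v : Fin n → ℝ} {b : ℝ} (h : v ⬝ᵥ (M *ᵥ v) ≤ b) :
    enorm2 v ≤ Real.sqrt (1 / lamMin M * b) := by
  have hl := lamMin_pos hn hM
  refine Real.le_sqrt_of_sq_le ?_
  have := lamMin_mul_enorm2_sq_le hM.isHermitian v
  rw [one_div, inv_mul_eq_div, le_div_iff₀ hl]
  linarith

/-- Continuity of eigenvalues is bypassed: L⁻¹ - P⁻¹ ≤ δ I with δ → 0, so P⁻¹ ≥ (`lamMin L⁻¹` - δ)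
I. In `EReal` the limsup needs no boundedness conditions. -/
theorem limsup_enorm2_le (hn : 0 < n) (hP : ∀ k, (P k).PosDef) (hL : L.PosDef)
    (hPL : Tendsto P atTop (𝓝 L)) {b : ℕ → ℝ} {β : ℝ} (hb : Tendsto b atTop (𝓝 β))
    (h : ∀ k, e k ⬝ᵥ ((P k)⁻¹ *ᵥ e k) ≤ b k) :
    limsup (fun k => (enorm2 (e k) : EReal)) atTop ≤ (Real.sqrt (β / lamMin L⁻¹) : EReal) := by
  have hl := lamMin_pos hn hL.inv
  have hinv := tendsto_inv_of_posDef hPL hL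
  set δ : ℕ → ℝ := fun k => ∑ i, ∑ j, |(L⁻¹ - (P k)⁻¹) i j| with hδ
  have hδ0 : Tendsto δ atTop (𝓝 0) := by
    have hc : Continuous fun M : Matrix (Fin n) (Fin n) ℝ => ∑ i, ∑ j, |(L⁻¹ - M) i j| := by
      fun_prop
    have := (hc.tendsto L⁻¹).comp hinv
    simpa [Function.comp_def, hδ] using this
  have hden : Tendsto (fun k => lamMin L⁻¹ - δ k) atTop (𝓝 (lamMin L⁻¹)) := by
    simpa using hδ0.const_sub (lamMin L⁻¹)
  have hev : ∀ᶠ k in atTop, enorm2 (e k) ≤ Real.sqrt (b k / (lamMin L⁻¹ - δ k)) := by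
    filter_upwards [hden.eventually_const_lt hl] with k hk
    refine Real.le_sqrt_of_sq_le ?_
    rw [le_div_iff₀ hk]
    have h1 := lamMin_mul_enorm2_sq_le hL.inv.isHermitian (e k)
    have h2 := form_le_of_le (le_sum_abs_smul_one
      (hL.inv.isHermitian.sub (hP k).inv.isHermitian)) (e k)
    rw [form_smul_one, ← enorm2_sq, sub_mulVec, dotProduct_sub] at h2
    have h3 := h k
    change _ ≤ δ k * _ at h2
    linarith
  have hlim : Tendsto (fun k => ((Real.sqrt (b k / (lamMin L⁻¹ - δ k)) : ℝ) : EReal)) atTop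
      (𝓝 ((Real.sqrt (β / lamMin L⁻¹) : ℝ) : EReal)) :=
    (continuous_coe_real_ereal.tendsto _).comp
      ((Real.continuous_sqrt.tendsto _).comp (hb.div hden hl.ne'))
  rw [← hlim.limsup_eq]
  refine limsup_le_limsup ?_
  filter_upwards [hev] with k hk
  exact_mod_cast hk

/-- Error bounds from a Lyapunov function dominating `eᵀ P⁻¹ e`. -/
theorem error_bounds (hn : 0 < n) (hP : ∀ k, (P k).PosDef) (hL : L.PosDef)
    (hPL : Tendsto P atTop (𝓝 L)) {V : ℕ → ℝ} {α β : ℝ} (hα : 0 < α) (hα1 : α ≤ 1)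
    (hV : ∀ k, V (k + 1) ≤ (1 - α) * V k + β)
    (h : ∀ k, e k ⬝ᵥ ((P k)⁻¹ *ᵥ e k) ≤ V k) :
    (∀ k, enorm2 (e k) ≤ Real.sqrt (1 / lamMin (P k)⁻¹ *
      ((1 - α) ^ k * V 0 + (1 - (1 - α) ^ k) / α * β))) ∧
    limsup (fun k => (enorm2 (e k) : EReal)) atTop
      ≤ (Real.sqrt (β / (α * lamMin L⁻¹)) : EReal) := by
  have hb := fun k => (h k).trans (le_of_linear_recursion hα hα1 hV k)
  refine ⟨fun k => enorm2_le_sqrt hn (hP k).inv (hb k), ?_⟩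
  rw [← div_div]
  refine limsup_enorm2_le hn hP hL hPL ?_ hb
  have hpow := tendsto_pow_atTop_nhds_zero_of_lt_one (sub_nonneg.2 hα1)
    (by linarith : 1 - α < 1)
  have := (hpow.mul_const (V 0)).add (((hpow.const_sub 1).div_const α).mul_const β)
  convert this using 2
  ring

end ErrorBounds

/-! ### The Lyapunov function along the filter. -/

section Filter

variable {n p m : ℕ} {A : Matrix (Fin n) (Fin n) ℝ} {C : Matrix (Fin p) (Fin n) ℝ}
  {D : Matrix (Fin p) (Fin m) ℝ} {Q : Matrix (Fin n) (Fin n) ℝ} {R : Matrix (Fin p) (Fin p) ℝ}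
  {lam1 lam2 gam1 gam2 w : Fin p → ℝ}
  {Pp Pu : ℕ → Matrix (Fin n) (Fin n) ℝ} {K : ℕ → Matrix (Fin n) (Fin p) ℝ}
  {U T6bar : Matrix (Fin m) (Fin m) ℝ} {eps α μ : ℝ}
  {d : ℕ → Fin m → ℝ} {x : ℕ → Fin n → ℝ} {y : ℕ → Fin p → ℝ}
  {xp xu : ℕ → Fin n → ℝ} {σ ε : ℕ → Fin p → ℝ}

theorem IsEstimator.eps_pos (hlam2 : ∀ i, 0 < lam2 i) (hgam2 : ∀ i, 0 < gam2 i)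
    (h : IsEstimator A C K lam1 lam2 gam1 gam2 y xp xu σ ε) (k : ℕ) (i : Fin p) :
    0 < ε k i := by
  induction k with
  | zero => exact h.eps_init i
  | succ k ih =>
    rw [h.eps_step]
    exact add_pos_of_pos_of_nonneg (mul_pos (hlam2 i) ih)
      (mul_nonneg (hgam2 i).le (sq_nonneg _))

theorem IsEstimator.sigma_pos (hlam1 : ∀ i, 0 < lam1 i) (hlam2 : ∀ i, 0 < lam2 i)
    (hgam1 : ∀ i, 0 < gam1 i) (hgam2 : ∀ i, 0 < gam2 i)
    (h : IsEstimator A C K lam1 lam2 gam1 gam2 y xp xu σ ε) (k : ℕ) (i : Fin p) :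
    0 < σ k i := by
  induction k with
  | zero => exact h.sigma_init i
  | succ k ih =>
    rw [h.sigma_step]
    have := h.eps_pos hlam2 hgam2 k i
    have := hlam1 i
    have := hgam1 i
    positivity

/-- This is t ≤ exp(t - 1) multiplied by exp(-t); it produces the constant ρ. -/
theorem mul_exp_neg_le_exp_neg_one (t : ℝ) : t * Real.exp (-t) ≤ Real.exp (-1) := by
  have h := Real.add_one_le_exp (t - 1)
  have h2 : Real.exp (t - 1) * Real.exp (-t) = Real.exp (-1) := by
    rw [← Real.exp_add]; congr 1; ring
  rw [← h2]
  exact mul_le_mul_of_nonneg_right (by linarith) (Real.exp_pos _).le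

theorem mul_exp_neg_le_self {t : ℝ} (ht : 0 ≤ t) : t * Real.exp (-t) ≤ t :=
  mul_le_of_le_one_right ht (Real.exp_le_one_iff.2 (by linarith))

theorem posSemidef_T6 (hG2 : ∀ i, 0 ≤ gam2 i) (hR : R.PosDef)
    {P Qb : Matrix (Fin n) (Fin n) ℝ} (hle : Qb ≤ P) :
    (T6 C D R (diagonal gam2) Qb P).PosSemidef := by
  have hRi : R⁻¹ᵀ = R⁻¹ := isHermitian_iff_isSymm.1 hR.inv.isHermitian
  have h1 := mul_mul_transpose_posSemidef (Matrix.le_iff.1 hle) (R⁻¹ * C)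
  rw [transpose_mul, hRi, ← Matrix.mul_assoc] at h1
  exact transpose_mul_mul_posSemidef (h1.add (PosSemidef.diagonal hG2)) D

theorem T6_mono (hR : R.PosDef) {P P' Qb Qb' : Matrix (Fin n) (Fin n) ℝ}
    (h : P - Qb ≤ P' - Qb') (G2 : Matrix (Fin p) (Fin p) ℝ) :
    T6 C D R G2 Qb P ≤ T6 C D R G2 Qb' P' := by
  have hRi : R⁻¹ᵀ = R⁻¹ := isHermitian_iff_isSymm.1 hR.inv.isHermitian
  have h1 := mul_mul_transpose_mono h (R⁻¹ * C)
  rw [transpose_mul, hRi, ← Matrix.mul_assoc, ← Matrix.mul_assoc] at h1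
  have h2 := mul_mul_transpose_mono (add_le_add_left h1 G2) Dᵀ
  rwa [transpose_transpose] at h2

theorem IsCovariance.exists_T6_le (hQ : Q.PosDef) (hR : R.PosDef) (hAC : Detectable A C)
    (hcov : IsCovariance A C Q R Pp Pu K) (Qb : Matrix (Fin n) (Fin n) ℝ)
    (G2 : Matrix (Fin p) (Fin p) ℝ) :
    ∃ T6bar : Matrix (Fin m) (Fin m) ℝ, ∀ k, LoewnerLE (T6 C D R G2 Qb (Pu k)) T6bar := by
  obtain ⟨M, -, hM⟩ := exists_riccati_bound hQ hR hAC hcov.init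
    fun k hk => hcov.predict_eq hR hk
  -- T₆ is monotone in Pu, and Pu ≤ Pp ≤ M I.
  refine ⟨T6 C D R G2 Qb (M • 1), fun k => Matrix.le_iff.1 (T6_mono hR ?_ G2)⟩
  refine sub_le_sub_right (le_trans ?_ (hM k).2) _
  rw [hcov.update_eq hR (hM k).1]
  exact infoUpdate_le hR (hM k).1

/-- One step of the Lyapunov function `eᵀ P⁻¹ e + ∑ σ + ∑ ε`. -/
theorem lyapunov_step (hm : 0 < m) (hQ : Q.PosDef) (hR : R.PosDef)
    (hgam2 : ∀ i, 0 < gam2 i) (hcov : IsCovariance A C Q R Pp Pu K)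
    (heps : ∀ k, LoewnerLE (Pu k)⁻¹ (eps • 1))
    (hw : ∀ i, 0 < w i) (hU : U.PosDef)
    (hZ : ∀ k, (Z C D R (diagonal gam2) (Qbar A Q eps) (Pu k) (Pp k) (diagonal w) U α).PosSemidef)
    (hT6 : ∀ k, LoewnerLE (T6 C D R (diagonal gam2) (Qbar A Q eps) (Pu k)) T6bar)
    (hd : ∀ k, enorm2 (d k) ≤ μ) (hplant : IsPlant A C D d x y)
    (hest : IsEstimator A C K lam1 lam2 gam1 gam2 y xp xu σ ε)
    {e : ℕ → Fin n → ℝ} (he : ∀ k, e k = xp k - x k) (k : ℕ) :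
    e (k + 1) ⬝ᵥ ((Pp (k + 1))⁻¹ *ᵥ e (k + 1)) + ∑ i, ε (k + 1) i
      ≤ (1 - α) * (e k ⬝ᵥ ((Pp k)⁻¹ *ᵥ e k)) + lamMax (T6bar + U) * μ ^ 2
        + ∑ i, lam2 i * ε k i := by
  have hPu := hcov.posDef_update hQ hR k
  have hle : (Pu k)⁻¹ ≤ eps • (1 : Matrix (Fin n) (Fin n) ℝ) := heps k
  set r := y k - C *ᵥ xp k with hr
  set s := satVec (σ k) r with hs
  have hr' : r = D *ᵥ d k - C *ᵥ e k := by
    rw [hr, hplant.output, he, mulVec_sub]; abel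
  have he' : e (k + 1) = A *ᵥ (e k + (Pu k * Cᵀ * R⁻¹) *ᵥ s) := by
    rw [he (k + 1), hest.predict, hest.update, hplant.state, ← mulVec_sub, he k,
      hcov.gain_eq hQ hR k]
    congr 1
    abel
  have hpred := form_predict_le (A := A) hQ hPu hle (e k + (Pu k * Cᵀ * R⁻¹) *ᵥ s)
  rw [← he', ← hcov.predict] at hpred
  have hid := form_Z_eq (U := U) (α := α) hR (isHermitian_diagonal gam2) (isHermitian_diagonal w)
    hPu (Qbar_posSemidef (A := A) hQ hPu hle).isHermitian (hcov.inv_update hQ hR k)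
    (e k) (d k) r s hr'
  have hz := form_nonneg (hZ k) (Sum.elim (e k) (Sum.elim (s - r) (d k)))
  have hsector : (s - r) ⬝ᵥ (diagonal w *ᵥ s) ≤ 0 := by
    refine Finset.sum_nonpos fun i _ => ?_
    rw [mulVec_diagonal]
    have := mul_nonpos_of_nonneg_of_nonpos (hw i).le
      (sat_mul_sat_sub_nonpos (Real.sqrt_nonneg (σ k i)) (r i))
    simp only [hs, satVec, Pi.sub_apply]
    linarith
  have heq : ∑ i, ε (k + 1) i = ∑ i, lam2 i * ε k i + r ⬝ᵥ (diagonal gam2 *ᵥ r) := by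
    rw [dotProduct, ← Finset.sum_add_distrib]
    refine Finset.sum_congr rfl fun i _ => ?_
    rw [hest.eps_step, mulVec_diagonal, hr, Pi.sub_apply]
    ring
  have hT6' : T6 C D R (diagonal gam2) (Qbar A Q eps) (Pu k) ≤ T6bar := hT6 k
  have hTps : T6bar.PosSemidef := by
    have h1 := (posSemidef_T6 (C := C) (D := D) (fun i => (hgam2 i).le) hR
      (Qbar_le (A := A) hQ hPu hle)).add (Matrix.le_iff.1 hT6')
    simpa using h1
  have hTU : (T6bar + U).PosDef := PosDef.posSemidef_add hTps hU
  -- The sign is needed to replace ‖d‖ by μ; it is read off at a basis vector, which exists because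
  -- m > 0.
  have hc1 : 0 ≤ lamMax (T6bar + U) := by
    have h1 := le_lamMax_mul_enorm2_sq hTU.isHermitian (Pi.single ⟨0, hm⟩ 1)
    have h2 := form_nonneg hTU.posSemidef (Pi.single ⟨0, hm⟩ 1)
    rw [enorm2_sq] at h1
    simp only [dotProduct_single, Pi.single_eq_same, mul_one] at h1
    linarith
  have hdd : d k ⬝ᵥ ((T6 C D R (diagonal gam2) (Qbar A Q eps) (Pu k) + U) *ᵥ d k)
      ≤ lamMax (T6bar + U) * μ ^ 2 :=
    (form_le_of_le (add_le_add_left hT6' U) (d k)).trans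
      ((le_lamMax_mul_enorm2_sq hTU.isHermitian (d k)).trans
        (mul_le_mul_of_nonneg_left (pow_le_pow_left₀ (enorm2_nonneg _) (hd k) 2) hc1))
  rw [heq]
  linarith

end Filter

end ISKF

/-! ### The main theorem. -/

theorem theorem2 {n p m : ℕ} (hn : 0 < n) (hp : 0 < p) (hm : 0 < m)
    -- the system and the design matrices
    (A : Matrix (Fin n) (Fin n) ℝ) (C : Matrix (Fin p) (Fin n) ℝ) (D : Matrix (Fin p) (Fin m) ℝ)
    (Q : Matrix (Fin n) (Fin n) ℝ) (R : Matrix (Fin p) (Fin p) ℝ)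
    (hA : IsUnit A) (hQ : Q.PosDef) (hR : R.PosDef) (hAC : ISKF.Detectable A C)
    -- the parameters of the saturation bound
    (lam1 lam2 gam1 gam2 : Fin p → ℝ)
    (hlam1 : ∀ i, 0 < lam1 i ∧ lam1 i < 1) (hlam2 : ∀ i, 0 < lam2 i ∧ lam2 i < 1)
    (hgam1 : ∀ i, 0 < gam1 i) (hgam2 : ∀ i, 0 < gam2 i)
    -- the covariances and gains of the filter
    (Pp Pu : ℕ → Matrix (Fin n) (Fin n) ℝ) (K : ℕ → Matrix (Fin n) (Fin p) ℝ)
    (hcov : ISKF.IsCovariance A C Q R Pp Pu K) :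
    -- the limit covariance and the bound `P_{k|k}⁻¹ ≤ ϵ I` exist
    ∃ Pinf : Matrix (Fin n) (Fin n) ℝ,
      Pinf.PosDef ∧ ISKF.IsRiccatiSolution A C Q R Pinf ∧ Tendsto Pp atTop (𝓝 Pinf) ∧
      (∃ eps : ℝ, ∀ k, ISKF.LoewnerLE (Pu k)⁻¹ (eps • 1)) ∧
      -- for every admissible choice of `ϵ`, `W`, `U`, `α`
      ∀ eps : ℝ, (∀ k, ISKF.LoewnerLE (Pu k)⁻¹ (eps • 1)) →
      ∀ (w : Fin p → ℝ) (U : Matrix (Fin m) (Fin m) ℝ) (α : ℝ),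
        (∀ i, 0 < w i) → U.PosDef → 0 < α →
        (∀ k, (ISKF.Z C D R (diagonal gam2) (ISKF.Qbar A Q eps) (Pu k) (Pp k)
          (diagonal w) U α).PosSemidef) →
        (∀ i, α ≤ 1 - lam1 i ∧ α ≤ 1 - lam2 i) →
        -- an upper bound of `T_{6,k}` exists, and any such bound may be used
        (∃ T6bar : Matrix (Fin m) (Fin m) ℝ, ∀ k,
          ISKF.LoewnerLE (ISKF.T6 C D R (diagonal gam2) (ISKF.Qbar A Q eps) (Pu k)) T6bar) ∧
        ∀ T6bar : Matrix (Fin m) (Fin m) ℝ,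
        (∀ k, ISKF.LoewnerLE
          (ISKF.T6 C D R (diagonal gam2) (ISKF.Qbar A Q eps) (Pu k)) T6bar) →
        -- every bounded outlier signal, every trajectory and every run of the filter
        ∀ (μ : ℝ) (d : ℕ → Fin m → ℝ) (x : ℕ → Fin n → ℝ) (y : ℕ → Fin p → ℝ)
          (xp xu : ℕ → Fin n → ℝ) (σ ε : ℕ → Fin p → ℝ),
        (∀ k, ISKF.enorm2 (d k) ≤ μ) →
        ISKF.IsPlant A C D d x y →
        ISKF.IsEstimator A C K lam1 lam2 gam1 gam2 y xp xu σ ε →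
        ∀ (e : ℕ → Fin n → ℝ) (ρ V₀ c₁ c₃ : ℝ) (c₂ : ℕ → ℝ),
        (∀ k, e k = xp k - x k) →
        ρ = Real.exp (-1) * ∑ i, gam1 i →
        V₀ = ISKF.V0 (Pp 0) (e 0) (σ 0) (ε 0) →
        c₁ = ISKF.lamMax (T6bar + U) →
        (∀ k, c₂ k = ISKF.lamMin (Pp k)⁻¹) →
        c₃ = ISKF.lamMin Pinf⁻¹ →
        ((∀ k, ISKF.enorm2 (e k) ≤
            Real.sqrt (1 / c₂ k *
              ((1 - α) ^ k * V₀ + (1 - (1 - α) ^ k) / α * (c₁ * μ ^ 2 + ρ)))) ∧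
          limsup (fun k => (ISKF.enorm2 (e k) : EReal)) atTop ≤
            (Real.sqrt ((c₁ * μ ^ 2 + ρ) / (α * c₃)) : EReal)) ∧
        ((∀ i, α ≤ 1 - lam1 i ∧ α ≤ 1 - (lam2 i + gam1 i)) →
          (∀ k, ISKF.enorm2 (e k) ≤
            Real.sqrt (1 / c₂ k *
              ((1 - α) ^ k * V₀ + (1 - (1 - α) ^ k) / α * (c₁ * μ ^ 2)))) ∧
          limsup (fun k => (ISKF.enorm2 (e k) : EReal)) atTop ≤
            ((Real.sqrt (c₁ / (α * c₃)) * μ : ℝ) : EReal)) := by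
  have hPd := hcov.posDef_predict hQ hR
  obtain ⟨Pinf, hPinf, hlim⟩ := ISKF.exists_tendsto_riccati hQ hR hAC hcov.init
    fun k hk => hcov.predict_eq hR hk
  refine ⟨Pinf, hPinf, ISKF.isRiccatiSolution_of_tendsto hR hPd
    (fun k => hcov.predict_eq hR (hPd k)) hPinf hlim, hlim, hcov.exists_inv_update_le hQ hR, ?_⟩
  intro eps heps w U α hw hU hα hZ hαlam
  refine ⟨hcov.exists_T6_le hQ hR hAC _ _, ?_⟩
  intro T6bar hT6 μ d x y xp xu σ ε hd hplant hest e ρ V₀ c₁ c₃ c₂ he hρ hV₀ hc₁ hc₂ hc₃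
  have hα1 : α ≤ 1 := by linarith [(hαlam ⟨0, hp⟩).1, (hlam1 ⟨0, hp⟩).1]
  have hσ0 := hest.sigma_pos (fun i => (hlam1 i).1) (fun i => (hlam2 i).1) hgam1 hgam2
  have hε0 := hest.eps_pos (fun i => (hlam2 i).1) hgam2
  have hμ0 : 0 ≤ μ := (ISKF.enorm2_nonneg _).trans (hd 0)
  have hstep := ISKF.lyapunov_step hm hQ hR hgam2 hcov heps hw hU hZ hT6 hd hplant hest he
  rw [← hc₁] at hstep
  set V : ℕ → ℝ := fun k => ISKF.V0 (Pp k) (e k) (σ k) (ε k) with hV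
  have hVdom : ∀ k, e k ⬝ᵥ ((Pp k)⁻¹ *ᵥ e k) ≤ V k := fun k => by
    have h1 := Finset.sum_nonneg fun i (_ : i ∈ Finset.univ) => (hσ0 k i).le
    have h2 := Finset.sum_nonneg fun i (_ : i ∈ Finset.univ) => (hε0 k i).le
    simp only [hV, ISKF.V0]
    linarith
  -- Both pairs of bounds share this recursion; only the scalar budget β for the σ and ε sums
  -- differs, ρ in the first case and 0 in the second.
  have hrec : ∀ β : ℝ, (∀ k, ∑ i, σ (k + 1) i + ∑ i, lam2 i * ε k i
      ≤ (1 - α) * (∑ i, σ k i + ∑ i, ε k i) + β) →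
      ∀ k, V (k + 1) ≤ (1 - α) * V k + (c₁ * μ ^ 2 + β) := by
    intro β hβ k
    have h1 := hstep k
    have h2 := hβ k
    simp only [hV, ISKF.V0]
    linarith
  have hbounds := fun (β : ℝ) hβ =>
    ISKF.error_bounds (e := e) hn hPd hPinf hlim hα hα1 (hrec β hβ) hVdom
  have hV0 : V 0 = V₀ := hV₀.symm
  simp only [hV0, ← hc₂, ← hc₃] at hbounds
  refine ⟨hbounds ρ fun k => ?_, fun hαlam' => ?_⟩
  · rw [hρ, Finset.mul_sum, mul_add, Finset.mul_sum, Finset.mul_sum, ← Finset.sum_add_distrib,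
      ← Finset.sum_add_distrib, ← Finset.sum_add_distrib]
    refine Finset.sum_le_sum fun i _ => ?_
    rw [hest.sigma_step]
    have h1 := mul_le_mul_of_nonneg_right (hαlam i).1 (hσ0 k i).le
    have h2 := mul_le_mul_of_nonneg_right (hαlam i).2 (hε0 k i).le
    have h3 := mul_le_mul_of_nonneg_left (ISKF.mul_exp_neg_le_exp_neg_one (ε k i)) (hgam1 i).le
    linarith
  · have h := hbounds 0 fun k => by
      rw [add_zero, mul_add, Finset.mul_sum, Finset.mul_sum, ← Finset.sum_add_distrib,
        ← Finset.sum_add_distrib]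
      refine Finset.sum_le_sum fun i _ => ?_
      rw [hest.sigma_step]
      have h1 := mul_le_mul_of_nonneg_right (hαlam' i).1 (hσ0 k i).le
      have h2 := mul_le_mul_of_nonneg_right (hαlam' i).2 (hε0 k i).le
      -- Here the input to σ is charged to ε, which is why α must leave room for λ₂ + γ₁.
      have h3 := mul_le_mul_of_nonneg_left (ISKF.mul_exp_neg_le_self (hε0 k i).le) (hgam1 i).le
      linarith
    rw [add_zero] at h
    refine ⟨h.1, h.2.trans_eq ?_⟩
    rw [mul_div_right_comm, Real.sqrt_mul' _ (sq_nonneg μ), Real.sqrt_sq hμ0]
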